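/- **Setting.** An input is a finite set $Q$ of jobs; job $q$ has a release time $r_q\ge 0$, a processing time $p_q>0$, a weight $w_q>0$ and a predicted processing time $\tilde p_q$. Jobs run preemptively on a single machine, and the weighted flow time of a schedule that completes job $q$ at time $c_q$ is $\sum_{q} w_q(c_q-r_q)$. Let $W=\max_q w_q/\min_q w_q$. An online algorithm learns $w_q$ and $\tilde p_q$ at time $r_q$, but it learns $p_q$ only when $q$ is completed. For $\mu>1$, an algorithm is $\mu$-robust with competitive ratio $c$ if, on every input with $\tilde p_q\le p_q<\mu\tilde p_q$ for all $q$, it completes all jobs and its weighted flow time is at most $c$ times that of an optimal (offline) schedule. **The algorithm (for a given $\mu>1$).** Round each weight up to a power of $2$. For each $i\in\mathbb Z$ maintain a superbin $A^i$ consisting of a full bin $F^i$ and a partial bin $P^i$, whose pending jobs are linearly ordered by priority. * When a job $q$ of rounded weight $2^i$ is released, insert it into $F^i$ with the highest priority. Let $q_1,\dots,q_m$ be the other jobs $q'$ of $F^i$ with $\mu\,\tilde p_{q'}\le\tilde p_q$, in order of decreasing priority. If $m\ge 1$, simultaneously give $q$ the priority of $q_m$, give $q_j$ the priority of $q_{j-1}$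 for $2\le j\le m$, and give $q_1$ the (highest) priority of $q$. * Whenever $|F^i|>|P^i|$, move the highest-priority job of $F^i$ to $P^i$, where it receives the highest priority. * At any time, choose $i$ such that the total rounded weight of $P^i$ is maximum (ties are broken arbitrarily), and process the highest-priority job of $P^i$. **Theorem.** There is an absolute constant $C>0$ such that, for every $\mu>1$ and every tie-breaking rule, the algorithm above is a $\mu$-robust online algorithm for weighted flow time with competitive ratio at most $C\mu^2\max\{1,\log_2 W\}$; that is, it is $O(\mu^2\log W)$-competitive. -/

import Mathlib

namespace SPPT

/-! ## Instances, schedules, weighted flow time -/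

/-- A finite input. Jobs are numbered in the order in which they are released; jobs with the same
release time are presented to an online algorithm in the order of their numbers. -/
structure Instance where
  n : ℕ
  release : Fin n → ℝ
  /-- the real processing time `p_q` -/
  proc : Fin n → ℝ
  weight : Fin n → ℝ
  /-- the predicted processing time of a job -/
  pred : Fin n → ℝ
  release_nonneg : ∀ q, 0 ≤ release q
  release_mono : Monotone release
  proc_pos : ∀ q, 0 < proc q
  weight_pos : ∀ q, 0 < weight q

/-- The distortion condition: prediction `≤` processing time `< μ *` prediction, for every job. -/
def Instance.HasDistortion (I : Instance) (μ : ℝ) : Prop :=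
  ∀ q, I.pred q ≤ I.proc q ∧ I.proc q < μ * I.pred q

/-- `W`: the ratio of the maximum weight to the minimum weight. -/
noncomputable def Instance.weightRatio (I : Instance) : ℝ :=
  (⨆ q, I.weight q) / (⨅ q, I.weight q)

/-- A preemptive single-machine schedule: the job processed at each time (`none` means idle). -/
abbrev Schedule (n : ℕ) : Type := ℝ → Option (Fin n)

/-- The amount of time spent on job `q` before time `t`. -/
noncomputable def Schedule.processed {n : ℕ} (S : Schedule n) (q : Fin n) (t : ℝ) : ℝ :=
  MeasureTheory.volume.real {s : ℝ | 0 ≤ s ∧ s < t ∧ S s = some q}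

/-- No job is processed before its release, and every job is completed eventually. -/
structure Instance.Feasible (I : Instance) (S : Schedule I.n) : Prop where
  measurable : ∀ q, MeasurableSet {s : ℝ | S s = some q}
  released : ∀ s q, S s = some q → I.release q ≤ s
  completed : ∀ q, ∃ t, I.proc q ≤ S.processed q t

/-- The first time at which `q` has been processed for `p_q` time units. -/
noncomputable def Instance.completionTime (I : Instance) (S : Schedule I.n) (q : Fin I.n) : ℝ :=
  sInf {t : ℝ | I.proc q ≤ S.processed q t}

/-- Total weighted flow time. -/
noncomputable def Instance.flowTime (I : Instance) (S : Schedule I.n) : ℝ :=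
  ∑ q, I.weight q * (I.completionTime S q - I.release q)

/-! ## Online algorithms with predicted processing times -/

/-- A deterministic online algorithm for scheduling with predicted processing times. When a job
arrives, the algorithm learns the time, the number of the job, its weight and its prediction, but
not its processing time. When a job is completed, it learns the time and the number of the job.
Between two such events, it processes the job selected by its current state. -/
structure OnlineAlgorithm where
  State : Type
  init : State
  /-- arguments: state, current time, job number, weight, predicted processing time -/
  onRelease : State → ℝ → ℕ → ℝ → ℝ → State
  /-- arguments: state, current time, job number -/
  onCompletion : State → ℝ → ℕ → State
  process : State → Option ℕ

/-- A snapshot of a run of `A` on `I`: current time, state of `A`, the time spent so far on each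
job, and the number of jobs that have arrived so far. -/
structure Config (A : OnlineAlgorithm) (I : Instance) where
  time : ℝ
  state : A.State
  work : Fin I.n → ℝ
  arrived : ℕ

/-- The job on the machine: the job selected by the algorithm, if it has arrived and is
unfinished; otherwise the machine is idle. -/
noncomputable def Config.running {A : OnlineAlgorithm} {I : Instance} (c : Config A I) :
    Option (Fin I.n) :=
  (A.process c.state).bind fun j =>
    if h : j < I.n then
      if j < c.arrived ∧ c.work ⟨j, h⟩ < I.proc ⟨j, h⟩ then some ⟨j, h⟩ else none
    else none

/-- One step of a run. If the next job in order has its release time now, it is handed to the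
algorithm. Otherwise the time advances, while the selected job is being processed, to the next
release or to the completion of that job, whichever comes first; a completion is reported to the
algorithm (before a release at the same time). If nothing is left to happen, the run stands
still. -/
noncomputable def Config.step {A : OnlineAlgorithm} {I : Instance} (c : Config A I) :
    Config A I :=
  if h : c.arrived < I.n then
    if I.release ⟨c.arrived, h⟩ ≤ c.time then
      { c with
        state := A.onRelease c.state c.time c.arrived
          (I.weight ⟨c.arrived, h⟩) (I.pred ⟨c.arrived, h⟩)
        arrived := c.arrived + 1 }
    else
      match c.running with
      | none => { c with time := I.release ⟨c.arrived, h⟩ }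
      | some q =>
        if I.release ⟨c.arrived, h⟩ < c.time + (I.proc q - c.work q) then
          { c with
            time := I.release ⟨c.arrived, h⟩
            work := Function.update c.work q
              (c.work q + (I.release ⟨c.arrived, h⟩ - c.time)) }
        else
          { c with
            time := c.time + (I.proc q - c.work q)
            work := Function.update c.work q (I.proc q)
            state := A.onCompletion c.state (c.time + (I.proc q - c.work q)) q }
  else
    match c.running with
    | none => c
    | some q =>
      { c with
        time := c.time + (I.proc q - c.work q)
        work := Function.update c.work q (I.proc q)
        state := A.onCompletion c.state (c.time + (I.proc q - c.work q)) q }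

/-- The run of `A` on `I`, step by step, starting at time `0`. -/
noncomputable def OnlineAlgorithm.run (A : OnlineAlgorithm) (I : Instance) : ℕ → Config A I
  | 0 => { time := 0, state := A.init, work := fun _ => 0, arrived := 0 }
  | k + 1 => (A.run I k).step

open Classical in
/-- The schedule produced by `A` on `I`: at time `s`, the job that is running during the step of
the run whose time interval contains `s`. -/
noncomputable def OnlineAlgorithm.schedule (A : OnlineAlgorithm) (I : Instance) :
    Schedule I.n := fun s =>
  if h : ∃ k, (A.run I k).time ≤ s ∧ s < (A.run I (k + 1)).time then
    (A.run I (Nat.find h)).running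
  else none

/-- `A` is `μ`-robust with competitive ratio `ratio`: on every input with distortion parameter at
most `μ`, it completes all jobs, and its weighted flow time is at most `ratio` times that of any
feasible (hence also of an optimal offline) schedule. -/
def OnlineAlgorithm.IsRobustCompetitive (A : OnlineAlgorithm) (μ : ℝ) (ratio : Instance → ℝ) :
    Prop :=
  ∀ I : Instance, I.HasDistortion μ →
    I.Feasible (A.schedule I) ∧
      ∀ S : Schedule I.n, I.Feasible S →
        I.flowTime (A.schedule I) ≤ ratio I * I.flowTime S

/-! ## The algorithm -/

/-- A superbin. Both bins are lists in order of increasing priority: the entry at position `k`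
(counted from `0`) has priority `k + 1`, so the last entry has the highest priority. A full bin
stores job numbers together with the predictions, a partial bin stores job numbers. -/
structure Superbin where
  full : List (ℕ × ℝ)
  partialBin : List ℕ

/-- Insertion of a job `q` into a full bin. The job `q` gets the highest priority, and then the
priorities of `q` and of all jobs `a` in violation with `q` (`bad a`) are rotated: `q` gets the
priority of the lowest-priority bad job, every bad job gets the priority of the next bad job above
it, and the topmost bad job gets the highest priority. All other jobs keep their priorities.

The list is traversed from low to high priority, with `q` the job waiting for the slot of the next
bad job (or for the top slot). -/
def rotateInsert {α : Type} (bad : α → Prop) [DecidablePred bad] : α → List α → List α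
  | q, [] => [q]
  | q, a :: l => if bad a then q :: rotateInsert bad a l else a :: rotateInsert bad q l

/-- If the full bin holds more jobs than the partial bin, the highest-priority job of the full bin
moves to the top of the partial bin. (It is called after every release and every completion, each
of which changes the number of jobs by one, so that one move restores the balance.) -/
def Superbin.rebalance (B : Superbin) : Superbin :=
  if B.partialBin.length < B.full.length then
    match B.full.getLast? with
    | some q => { full := B.full.dropLast, partialBin := B.partialBin ++ [q.1] }
    | none => B
  else B

open Classical in
/-- Release of job number `q` with prediction `y` to a superbin: the bad jobs are the jobs `a`
such that `(q, a)` is a violation, that is, `μ * (prediction of a) ≤ (prediction of q)`. -/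
noncomputable def Superbin.insertJob (μ : ℝ) (B : Superbin) (q : ℕ) (y : ℝ) : Superbin :=
  Superbin.rebalance
    { B with full := rotateInsert (fun a : ℕ × ℝ => μ * a.2 ≤ y) (q, y) B.full }

/-- Removal of a completed job. -/
def Superbin.complete (B : Superbin) (q : ℕ) : Superbin :=
  Superbin.rebalance { B with partialBin := B.partialBin.erase q }

/-- The state of the algorithm: one superbin for every weight class `2 ^ i`, `i ∈ ℤ`. -/
abbrev SuperbinState : Type := ℤ → Superbin

/-- The weight class of a job of weight `w`: the integer `i` with `2 ^ (i - 1) < w ≤ 2 ^ i`, that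
is, weights are rounded up to the next power of two. -/
noncomputable def weightClass (w : ℝ) : ℤ := Int.clog 2 w

/-- The (rounded) weight of the partial bin of the `i`-th superbin. -/
noncomputable def partialWeight (s : SuperbinState) (i : ℤ) : ℝ :=
  (s i).partialBin.length * (2 : ℝ) ^ i

/-- `pick` chooses a superbin whose partial bin is heaviest (whenever there is one, which is the
case if only finitely many superbins are nonempty); ties are broken arbitrarily. -/
def PicksHeaviest (pick : SuperbinState → ℤ) : Prop :=
  ∀ s, (∃ i, ∀ j, partialWeight s j ≤ partialWeight s i) →
    ∀ j, partialWeight s j ≤ partialWeight s (pick s)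

theorem exists_picksHeaviest : ∃ pick, PicksHeaviest pick := by
  classical
  refine ⟨fun s => if h : ∃ i, ∀ j, partialWeight s j ≤ partialWeight s i
    then h.choose else 0, fun s h => ?_⟩
  simp only [dif_pos h]
  exact h.choose_spec

/-- The algorithm: a released job is inserted into the superbin of its weight class; at any time,
the highest-priority job of the heaviest partial bin is processed. -/
noncomputable def superbinAlgorithm (μ : ℝ) (pick : SuperbinState → ℤ) : OnlineAlgorithm where
  State := SuperbinState
  init := fun _ => { full := [], partialBin := [] }
  onRelease := fun s _ q w y =>
    Function.update s (weightClass w) ((s (weightClass w)).insertJob μ q y)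
  onCompletion := fun s _ q i => (s i).complete q
  process := fun s => (s (pick s)).partialBin.getLast?

end SPPT

/-! Fix a time `t`, an arbitrary feasible schedule `S`, and let `O` be the set of jobs released by
`t` that `S` has not completed before `t`. The aim is to show that at time `t` every partial bin has
rounded weight at most `N` times the rounded weight of `O`, where `N = ⌈μ ^ 2⌉₊`. Full bins are no
longer than partial bins, and there are `O(log W)` weight classes, so the pending weight of the
algorithm is `O(μ ^ 2 log W)` times that of `S`. Integrating over `t` gives the bound on flow times.

The bound on partial bins is a volume argument along the whole run, with `O` kept fixed. The lowest
`N * load / 2 ^ i` positions of each bin of class `i` are charged to the jobs of `O` that have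
arrived. The invariant `excess_le_residual` says that the remaining volume above these thresholds is
at most what `S` still has to process of the arrived jobs outside `O`. Processing preserves it:
measured in weight the threshold is the same for all classes, so if some partial bin exceeds it,
then so does the heaviest one. The running job is then above the threshold, and the excess falls at
rate one, while the residual falls at rate at most one. A release outside `O` adds the size of the
job to the residual and at most that to the excess, because rotation moves upwards only jobs that
are certainly no larger. A release in `O` raises the threshold of its class by `N`, and this absorbs
the new job, because jobs not in violation with it are smaller by a factor of at most `μ ^ 2`. Both
comparisons use that jobs in full bins are untouched. At time `t` the residual is zero, so no
partial bin can exceed its threshold (`length_partialBin_le`). -/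

open MeasureTheory Set

namespace SPPT

/-! ### Volume estimates for the rotation in a full bin -/

section RotateInsert

variable {α : Type} (bad : α → Prop) [DecidablePred bad]

theorem rotateInsert_perm (q : α) (l : List α) : (rotateInsert bad q l).Perm (q :: l) := by
  induction l generalizing q with
  | nil => exact List.Perm.refl _
  | cons a l ih =>
    by_cases h : bad a
    · simpa [rotateInsert, h] using ih a
    · simpa [rotateInsert, h] using ((ih q).cons a).trans (List.Perm.swap q a l)

variable {bad} {v : α → ℝ} {V : ℝ}

/-- Inserting a job increases the volume above any fixed position by at most its size. -/
theorem sum_drop_rotateInsert_le (hV : 0 ≤ V) (q : α) (hq : v q ≤ V) (l : List α)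
    (hbad : ∀ a ∈ l, bad a → v a ≤ V) (M : ℕ) :
    (((rotateInsert bad q l).drop M).map v).sum ≤ ((l.drop M).map v).sum + V := by
  induction l generalizing q M with
  | nil =>
    cases M with
    | zero => simpa [rotateInsert] using hq
    | succ M => simpa [rotateInsert] using hV
  | cons a l ih =>
    have hl : ∀ b ∈ l, bad b → v b ≤ V := fun b hb => hbad b (List.mem_cons_of_mem _ hb)
    cases M with
    | zero =>
      have h := (((rotateInsert_perm bad q (a :: l)).map v).sum_eq)
      simp only [List.drop_zero, h, List.map_cons, List.sum_cons]
      linarith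
    | succ M =>
      -- Past a bad slot the waiting job is `a`, again of size at most `V`; hence the induction is
      -- over all waiting jobs of size at most `V`.
      by_cases h : bad a
      · simpa [rotateInsert, h] using ih a (hbad a (by simp) h) hl M
      · simpa [rotateInsert, h] using ih q hq hl M

/-- The new job settles in the first bad slot, or on top if there is none. So the lowest `k`
positions either contain it or hold only good jobs. -/
theorem min_le_sum_take_rotateInsert {δ : ℝ} (hδ : 0 ≤ δ) (q : α) (l : List α)
    (hnn : ∀ a ∈ l, 0 ≤ v a) (hgood : ∀ a ∈ l, ¬ bad a → δ ≤ v a) (k : ℕ)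
    (hk : k ≤ l.length + 1) :
    min (v q) (k * δ) ≤ (((rotateInsert bad q l).take k).map v).sum := by
  induction l generalizing k with
  | nil =>
    cases k with
    | zero => simp
    | succ k => simp [rotateInsert]
  | cons a l ih =>
    cases k with
    | zero => simp
    | succ k =>
      by_cases h : bad a
      · refine (min_le_left _ _).trans ?_
        have : 0 ≤ (((rotateInsert bad a l).take k).map v).sum := by
          refine List.sum_nonneg fun x hx => ?_
          obtain ⟨b, hb, rfl⟩ := List.mem_map.1 hx
          exact hnn b ((rotateInsert_perm bad a l).mem_iff.1 (List.mem_of_mem_take hb))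
        simpa [rotateInsert, h] using this
      · have := ih (fun b hb => hnn b (List.mem_cons_of_mem _ hb))
          (fun b hb => hgood b (List.mem_cons_of_mem _ hb)) k (by simpa using hk)
        have ha := hgood a (by simp) h
        simp only [rotateInsert, h, if_false, List.take_succ_cons, List.map_cons, List.sum_cons]
        push_cast
        rcases min_cases (v q) (k * δ) with ⟨h1, h2⟩ | ⟨h1, h2⟩
        · rw [h1] at this
          exact (min_le_left _ _).trans (by linarith)
        · rw [h1] at this
          exact (min_le_right _ _).trans (by linarith)

/-- If the threshold position is raised by `N`, where good jobs have size at least `V / N`, then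
inserting a job of size at most `V` does not increase the volume above the threshold. -/
theorem sum_drop_add_rotateInsert_le {N : ℕ} {δ : ℝ} (hδ : 0 ≤ δ) (hN : V ≤ N * δ) (q : α)
    (hq0 : 0 ≤ v q) (hq : v q ≤ V) (l : List α) (hnn : ∀ a ∈ l, 0 ≤ v a)
    (hbad : ∀ a ∈ l, bad a → v a ≤ V) (hgood : ∀ a ∈ l, ¬ bad a → δ ≤ v a) (M : ℕ)
    (hM : M + N ≤ l.length + 1) :
    (((rotateInsert bad q l).drop (M + N)).map v).sum ≤ ((l.drop M).map v).sum := by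
  induction M generalizing q l with
  | zero =>
    -- The total grows by `v q`, and the lowest `N` positions, now below the threshold, carry at
    -- least `v q`.
    have h1 := min_le_sum_take_rotateInsert hδ q l hnn hgood N (by simpa using hM)
    rw [min_eq_left (hq.trans hN)] at h1
    have h2 := ((rotateInsert_perm bad q l).map v).sum_eq
    rw [← List.take_append_drop N (rotateInsert bad q l)] at h2
    simp only [List.map_append, List.sum_append, List.map_cons, List.sum_cons] at h2
    simp only [Nat.zero_add, List.drop_zero]
    linarith
  | succ M ih =>
    cases l with
    | nil =>
      have : (rotateInsert bad q ([] : List α)).drop (M + 1 + N) = [] := by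
        rw [List.drop_eq_nil_iff]; simp [rotateInsert]; omega
      rw [this]; simp
    | cons a l =>
      have h1 : ∀ b ∈ l, 0 ≤ v b := fun b hb => hnn b (List.mem_cons_of_mem _ hb)
      have h2 : ∀ b ∈ l, bad b → v b ≤ V := fun b hb => hbad b (List.mem_cons_of_mem _ hb)
      have h3 : ∀ b ∈ l, ¬ bad b → δ ≤ v b := fun b hb => hgood b (List.mem_cons_of_mem _ hb)
      have h4 : M + N ≤ l.length + 1 := by simp at hM; omega
      rw [Nat.add_right_comm]
      by_cases h : bad a
      · simpa [rotateInsert, h] using ih a (hnn a (by simp)) (hbad a (by simp) h) l h1 h2 h3 h4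
      · simpa [rotateInsert, h] using ih q hq0 hq l h1 h2 h3 h4

end RotateInsert

/-! ### Excess volume of a single superbin -/

namespace Superbin

/-- All pending jobs of a superbin. -/
def jobs (B : Superbin) : List ℕ := B.full.map Prod.fst ++ B.partialBin

/-- The volume of the jobs above position `M` in the two bins. -/
def excess (v : ℕ → ℝ) (M : ℕ) (B : Superbin) : ℝ :=
  ((B.full.drop M).map fun a => v a.1).sum + ((B.partialBin.drop M).map v).sum

theorem rebalance_of_le {B : Superbin} (h : B.full.length ≤ B.partialBin.length) :
    B.rebalance = B := by
  simp [rebalance, Nat.not_lt.2 h]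

theorem exists_rebalance_eq {B : Superbin} (h : B.partialBin.length < B.full.length) :
    ∃ l a, B.full = l ++ [a] ∧ B.rebalance = ⟨l, B.partialBin ++ [a.1]⟩ := by
  obtain ⟨F, P⟩ := B
  rcases List.eq_nil_or_concat F with rfl | ⟨l, a, rfl⟩
  · simp at h
  · refine ⟨l, a, by simp, ?_⟩
    simp only [rebalance, h, if_true]
    simp

theorem jobs_rebalance_perm (B : Superbin) : B.rebalance.jobs.Perm B.jobs := by
  rcases lt_or_ge B.partialBin.length B.full.length with h | h
  · obtain ⟨l, a, h1, h2⟩ := exists_rebalance_eq h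
    simp only [jobs, h1, h2, List.map_append, List.append_assoc, List.map_cons, List.map_nil]
    exact List.Perm.append_left _ List.perm_append_comm
  · rw [rebalance_of_le h]

theorem mem_full_of_mem_rebalance {B : Superbin} {a : ℕ × ℝ} (ha : a ∈ B.rebalance.full) :
    a ∈ B.full := by
  rcases lt_or_ge B.partialBin.length B.full.length with h | h
  · obtain ⟨l, b, h1, h2⟩ := exists_rebalance_eq h
    rw [h2] at ha
    rw [h1]
    exact List.mem_append_left _ ha
  · rwa [rebalance_of_le h] at ha

/-- The two bins have almost the same number of jobs. -/
def Balanced (B : Superbin) : Prop :=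
  B.full.length ≤ B.partialBin.length ∧ B.partialBin.length ≤ B.full.length + 1

theorem balanced_rebalance {B : Superbin} (h1 : B.full.length ≤ B.partialBin.length + 1)
    (h2 : B.partialBin.length ≤ B.full.length + 1) : B.rebalance.Balanced := by
  rcases lt_or_ge B.partialBin.length B.full.length with h | h
  · obtain ⟨l, b, h3, h4⟩ := exists_rebalance_eq h
    have : B.full.length = l.length + 1 := by simp [h3]
    rw [h4]
    constructor <;> simp <;> omega
  · rw [rebalance_of_le h]
    exact ⟨h, h2⟩

theorem excess_nonneg {v : ℕ → ℝ} {B : Superbin} (hv : ∀ j, 0 ≤ v j) (M : ℕ) :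
    0 ≤ B.excess v M := by
  refine add_nonneg (List.sum_nonneg fun x hx => ?_) (List.sum_nonneg fun x hx => ?_) <;>
  · obtain ⟨a, -, rfl⟩ := List.mem_map.1 hx
    exact hv _

theorem excess_eq_zero {B : Superbin} (v : ℕ → ℝ) {M : ℕ} (h : B.partialBin.length ≤ M)
    (hB : B.full.length ≤ B.partialBin.length) : B.excess v M = 0 := by
  simp [excess, List.drop_eq_nil_of_le h, List.drop_eq_nil_of_le (hB.trans h)]

theorem sum_drop_anti {α : Type} {v : α → ℝ} (hv : ∀ j, 0 ≤ v j) (l : List α) {M M' : ℕ}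
    (h : M ≤ M') : ((l.drop M').map v).sum ≤ ((l.drop M).map v).sum := by
  obtain ⟨k, rfl⟩ := Nat.exists_eq_add_of_le h
  rw [← List.drop_drop]
  conv_rhs => rw [← List.take_append_drop k (l.drop M)]
  simp only [List.map_append, List.sum_append]
  have : 0 ≤ (((l.drop M).take k).map v).sum := List.sum_nonneg fun x hx => by
    obtain ⟨a, -, rfl⟩ := List.mem_map.1 hx
    exact hv _
  linarith

theorem excess_anti {v : ℕ → ℝ} {B : Superbin} (hv : ∀ j, 0 ≤ v j) {M M' : ℕ} (h : M ≤ M') :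
    B.excess v M' ≤ B.excess v M :=
  add_le_add (sum_drop_anti (v := fun a : ℕ × ℝ => v a.1) (fun a => hv a.1) _ h) (sum_drop_anti hv _ h)

theorem excess_mono {v v' : ℕ → ℝ} (h : ∀ j, v' j ≤ v j) (B : Superbin) (M : ℕ) :
    B.excess v' M ≤ B.excess v M := by
  unfold excess
  refine add_le_add (List.sum_le_sum ?_) (List.sum_le_sum ?_) <;> intro a _ <;> exact h _

/-- The two bins differ by one in length when a job moves, so it keeps its position and stays on the
same side of the threshold. -/
theorem excess_rebalance_le {v : ℕ → ℝ} {B : Superbin} (hv : ∀ j, 0 ≤ v j) (M : ℕ)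
    (hB : B.full.length ≤ B.partialBin.length + 1) : B.rebalance.excess v M ≤ B.excess v M := by
  rcases lt_or_ge B.partialBin.length B.full.length with h | h
  · obtain ⟨l, b, h3, h4⟩ := exists_rebalance_eq h
    have hl : B.full.length = l.length + 1 := by simp [h3]
    rcases lt_or_ge B.partialBin.length M with hM | hM
    · rw [excess_eq_zero (B := B.rebalance) v (by rw [h4]; simp; omega) (by rw [h4]; simp; omega)]
      exact excess_nonneg hv M
    · rw [h4]
      have : M ≤ l.length := by omega
      simp only [excess, h3, List.drop_append_of_le_length this, List.drop_append_of_le_length hM,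
        List.map_append, List.sum_append]
      simp only [List.map_cons, List.map_nil, List.sum_cons, List.sum_nil]
      linarith
  · rw [rebalance_of_le h]

variable {μ : ℝ} {B : Superbin} {q : ℕ} {y : ℝ}

theorem jobs_insertJob_perm (μ : ℝ) (B : Superbin) (q : ℕ) (y : ℝ) :
    (B.insertJob μ q y).jobs.Perm (q :: B.jobs) := by
  refine (jobs_rebalance_perm _).trans ?_
  simp only [jobs]
  exact ((rotateInsert_perm _ (q, y) B.full).map Prod.fst).append_right _

theorem mem_full_of_mem_insertJob {a : ℕ × ℝ} (ha : a ∈ (B.insertJob μ q y).full) :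
    a = (q, y) ∨ a ∈ B.full := by
  have := mem_full_of_mem_rebalance ha
  exact List.mem_cons.1 ((rotateInsert_perm _ (q, y) B.full).mem_iff.1 this)

theorem Balanced.insertJob (h : B.Balanced) (μ : ℝ) (q : ℕ) (y : ℝ) :
    (B.insertJob μ q y).Balanced := by
  obtain ⟨h1, h2⟩ := h
  have := (rotateInsert_perm (fun a : ℕ × ℝ => μ * a.2 ≤ y) (q, y) B.full).length_eq
  refine balanced_rebalance ?_ ?_ <;> (simp_all <;> omega)

theorem excess_insertJob_le {v : ℕ → ℝ} (hv : ∀ j, 0 ≤ v j) (hB : B.Balanced)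
    (hbad : ∀ a ∈ B.full, μ * a.2 ≤ y → v a.1 ≤ v q) (M : ℕ) :
    (B.insertJob μ q y).excess v M ≤ B.excess v M + v q := by
  refine (excess_rebalance_le hv M ?_).trans ?_
  · rw [(rotateInsert_perm _ (q, y) B.full).length_eq]
    simpa using hB.1
  · have := sum_drop_rotateInsert_le (bad := fun a : ℕ × ℝ => μ * a.2 ≤ y)
      (v := fun a : ℕ × ℝ => v a.1) (hv q) (q, y) le_rfl B.full hbad M
    simp only [excess]
    linarith

/-- Release of a job charged to `O`: raising the threshold by `N` pays for the insertion. -/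
theorem excess_add_insertJob_le {v : ℕ → ℝ} (hv : ∀ j, 0 ≤ v j) (hB : B.Balanced)
    (hbad : ∀ a ∈ B.full, μ * a.2 ≤ y → v a.1 ≤ v q) {N : ℕ} {δ : ℝ} (hδ : 0 ≤ δ)
    (hN : v q ≤ N * δ) (hgood : ∀ a ∈ B.full, ¬ μ * a.2 ≤ y → δ ≤ v a.1) (M : ℕ) :
    (B.insertJob μ q y).excess v (M + N) ≤ B.excess v M := by
  have hb := hB.insertJob μ q y
  have hl := (rotateInsert_perm (fun a : ℕ × ℝ => μ * a.2 ≤ y) (q, y) B.full).length_eq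
  -- If the new partial bin does not exceed the raised threshold, then nothing lies above it.
  -- Otherwise balance makes the full bin long enough for the rotation estimate.
  rcases le_or_gt (B.insertJob μ q y).partialBin.length (M + N) with h | h
  · rw [excess_eq_zero v h hb.1]
    exact excess_nonneg hv M
  · have h1 : M + N ≤ (B.insertJob μ q y).full.length := by have := hb.2; omega
    have h2 : (B.insertJob μ q y).full.length ≤ B.full.length + 1 := by
      set B' : Superbin :=
        { B with full := rotateInsert (fun a : ℕ × ℝ => μ * a.2 ≤ y) (q, y) B.full } with hB'
      have hlen : B'.full.length = B.full.length + 1 := by simpa [hB'] using hl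
      have : B'.rebalance.full.length ≤ B'.full.length := by
        rcases lt_or_ge B'.partialBin.length B'.full.length with h | h
        · obtain ⟨l, b, h3, h4⟩ := exists_rebalance_eq h
          rw [h4, h3]; simp
        · rw [rebalance_of_le h]
      rw [hlen] at this
      exact this
    refine (excess_rebalance_le hv (M + N) ?_).trans ?_
    · rw [(rotateInsert_perm _ (q, y) B.full).length_eq]
      simpa using hB.1
    · refine add_le_add ?_ (sum_drop_anti hv _ (Nat.le_add_right M N))
      exact sum_drop_add_rotateInsert_le (V := v q) (v := fun a : ℕ × ℝ => v a.1) hδ hN (q, y)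
        (hv q) le_rfl B.full (fun a _ => hv a.1) hbad hgood M (h1.trans h2)

section Complete

variable {L : List ℕ}

theorem complete_eq (hP : B.partialBin = L ++ [q]) (hq : q ∉ L) :
    B.complete q = rebalance { full := B.full, partialBin := L } := by
  simp [complete, hP, List.erase_append_right _ hq]

theorem jobs_complete_perm (hP : B.partialBin = L ++ [q]) (hq : q ∉ L) :
    (q :: (B.complete q).jobs).Perm B.jobs := by
  rw [complete_eq hP hq]
  refine ((jobs_rebalance_perm _).cons q).trans ?_
  simp only [jobs, hP, ← List.append_assoc]
  exact (List.perm_append_comm (l₁ := [q]))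

theorem mem_full_of_mem_complete {a : ℕ × ℝ} (ha : a ∈ (B.complete q).full) : a ∈ B.full :=
  mem_full_of_mem_rebalance (B := { B with partialBin := B.partialBin.erase q }) ha

theorem Balanced.complete (h : B.Balanced) (hP : B.partialBin = L ++ [q]) (hq : q ∉ L) :
    (B.complete q).Balanced := by
  obtain ⟨h1, h2⟩ := h
  rw [complete_eq hP hq]
  refine balanced_rebalance ?_ ?_ <;> (simp_all <;> omega)

theorem excess_complete_le {v : ℕ → ℝ} (hv : ∀ j, 0 ≤ v j) (h : B.Balanced)
    (hP : B.partialBin = L ++ [q]) (hq : q ∉ L) (M : ℕ) :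
    (B.complete q).excess v M ≤ B.excess v M := by
  rw [complete_eq hP hq]
  refine (excess_rebalance_le hv M (by simpa [hP] using h.1)).trans ?_
  simp only [excess, hP]
  refine add_le_add le_rfl ?_
  rw [List.drop_append, List.map_append, List.sum_append]
  have : 0 ≤ ((List.drop (M - L.length) [q]).map v).sum := List.sum_nonneg fun x hx => by
    obtain ⟨a, -, rfl⟩ := List.mem_map.1 hx
    exact hv _
  linarith

/-- If the topmost job of a partial bin lies above the threshold, then processing it decreases
the excess. -/
theorem excess_add_le_of_lt {v v' : ℕ → ℝ} (hle : ∀ j, v' j ≤ v j) {d : ℝ}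
    (hd : v' q + d ≤ v q) (hP : B.partialBin = L ++ [q]) {M : ℕ}
    (hM : M < B.partialBin.length) : B.excess v' M + d ≤ B.excess v M := by
  have hM' : M ≤ L.length := by simpa [hP, Nat.lt_succ_iff] using hM
  simp only [excess, hP, List.drop_append_of_le_length hM', List.map_append, List.sum_append,
    List.map_cons, List.map_nil, List.sum_cons, List.sum_nil]
  have h1 : ((B.full.drop M).map fun a => v' a.1).sum ≤ ((B.full.drop M).map fun a => v a.1).sum :=
    List.sum_le_sum fun a _ => hle a.1
  have h2 : ((L.drop M).map v').sum ≤ ((L.drop M).map v).sum := List.sum_le_sum fun a _ => hle a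
  linarith

end Complete

end Superbin

/-! ### Completion times in feasible schedules -/

section Processed

variable {n : ℕ} (S : Schedule n) (q : Fin n)

theorem Schedule.processed_set_subset (t : ℝ) :
    {s : ℝ | 0 ≤ s ∧ s < t ∧ S s = some q} ⊆ Ico 0 t := fun _ hs => ⟨hs.1, hs.2.1⟩

theorem Schedule.volume_processed_ne_top (t : ℝ) :
    volume {s : ℝ | 0 ≤ s ∧ s < t ∧ S s = some q} ≠ ⊤ :=
  measure_ne_top_of_subset (S.processed_set_subset q t) (by simp)

theorem Schedule.processed_mono : Monotone (S.processed q) := fun _ t' h =>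
  measureReal_mono (fun _ hs => ⟨hs.1, hs.2.1.trans_le h, hs.2.2⟩) (S.volume_processed_ne_top q t')

variable {I : Instance} {S : Schedule I.n}

theorem Instance.Feasible.processed_eq_zero (hS : I.Feasible S) {q : Fin I.n} {t : ℝ} (ht : t ≤ I.release q) :
    S.processed q t = 0 := by
  have : {s : ℝ | 0 ≤ s ∧ s < t ∧ S s = some q} = ∅ := by
    ext s
    simp only [mem_ofPred_eq, mem_empty_iff_false, iff_false]
    rintro ⟨-, h1, h2⟩
    exact absurd (hS.released s q h2) (by linarith)
  simp [Schedule.processed, this]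

theorem Instance.Feasible.release_lt_of_le_processed (hS : I.Feasible S) {q : Fin I.n} {t : ℝ}
    (ht : I.proc q ≤ S.processed q t) : I.release q < t := by
  by_contra h
  have := hS.processed_eq_zero (not_lt.1 h)
  linarith [I.proc_pos q]

theorem Instance.Feasible.release_le_completionTime (hS : I.Feasible S) (q : Fin I.n) :
    I.release q ≤ I.completionTime S q :=
  le_csInf (hS.completed q) fun _ ht => (hS.release_lt_of_le_processed ht).le

theorem Instance.Feasible.processed_lt_of_lt (hS : I.Feasible S) {q : Fin I.n} {t : ℝ}
    (ht : t < I.completionTime S q) : S.processed q t < I.proc q := by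
  by_contra h
  exact absurd (csInf_le ⟨I.release q, fun _ hs => (hS.release_lt_of_le_processed hs).le⟩
    (show t ∈ {t | I.proc q ≤ S.processed q t} from not_lt.1 h)) (not_le.2 ht)

theorem Instance.Feasible.le_processed_of_lt (hS : I.Feasible S) {q : Fin I.n} {t : ℝ}
    (ht : I.completionTime S q < t) : I.proc q ≤ S.processed q t := by
  obtain ⟨s, hs, hst⟩ := exists_lt_of_csInf_lt (hS.completed q) ht
  exact le_trans hs (S.processed_mono q hst.le)

end Processed

/-! ### Runs of an online algorithm and their schedules -/

section Run

variable {A : OnlineAlgorithm} {I : Instance}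

theorem Config.running_eq_some {c : Config A I} {q : Fin I.n} :
    c.running = some q ↔
      A.process c.state = some q.1 ∧ q.1 < c.arrived ∧ c.work q < I.proc q := by
  unfold Config.running
  constructor
  · intro h
    obtain ⟨j, hj, h⟩ := Option.bind_eq_some_iff.1 h
    split_ifs at h with h1 h2
    · obtain rfl := Option.some.inj h
      exact ⟨hj, h2⟩
  · rintro ⟨h1, h2⟩
    simp [h1, h2]

/-- The possible outcomes of a step. -/
inductive Config.StepCases (c : Config A I) : Config A I → Prop
  | release (h : c.arrived < I.n) (hr : I.release ⟨c.arrived, h⟩ ≤ c.time) :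
      StepCases c { c with
        state := A.onRelease c.state c.time c.arrived
          (I.weight ⟨c.arrived, h⟩) (I.pred ⟨c.arrived, h⟩)
        arrived := c.arrived + 1 }
  | idle (h : c.arrived < I.n) (hr : c.time < I.release ⟨c.arrived, h⟩) (hrun : c.running = none) :
      StepCases c { c with time := I.release ⟨c.arrived, h⟩ }
  | work (q : Fin I.n) (hrun : c.running = some q) (h : c.arrived < I.n)
      (hr : c.time < I.release ⟨c.arrived, h⟩)
      (hlt : I.release ⟨c.arrived, h⟩ < c.time + (I.proc q - c.work q)) :
      StepCases c { c with
        time := I.release ⟨c.arrived, h⟩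
        work := Function.update c.work q (c.work q + (I.release ⟨c.arrived, h⟩ - c.time)) }
  | complete (q : Fin I.n) (hrun : c.running = some q)
      (hle : ∀ h : c.arrived < I.n, c.time + (I.proc q - c.work q) ≤ I.release ⟨c.arrived, h⟩) :
      StepCases c { c with
        time := c.time + (I.proc q - c.work q)
        work := Function.update c.work q (I.proc q)
        state := A.onCompletion c.state (c.time + (I.proc q - c.work q)) q }
  | standstill (h : ¬ c.arrived < I.n) (hrun : c.running = none) : StepCases c c

theorem Config.stepCases_step (c : Config A I) : c.StepCases c.step := by
  unfold Config.step
  by_cases h : c.arrived < I.n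
  · rw [dif_pos h]
    by_cases hr : I.release ⟨c.arrived, h⟩ ≤ c.time
    · rw [if_pos hr]
      exact .release h hr
    · rw [if_neg hr]
      cases hrun : c.running with
      | none => exact .idle h (not_le.1 hr) hrun
      | some q =>
        dsimp only
        split_ifs with hlt
        · exact .work q hrun h (not_le.1 hr) hlt
        · exact .complete q hrun fun _ => not_lt.1 hlt
  · rw [dif_neg h]
    cases hrun : c.running with
    | none => exact .standstill h hrun
    | some q => exact .complete q hrun fun h' => absurd h' h

theorem Config.StepCases.time_le {c c' : Config A I} (h : c.StepCases c') : c.time ≤ c'.time := by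
  cases h with
  | release h hr => exact le_rfl
  | idle h hr hrun => exact hr.le
  | work q hrun h hr hlt => exact hr.le
  | complete q hrun hle =>
    have := (running_eq_some.1 hrun).2.2
    change c.time ≤ c.time + (I.proc q - c.work q)
    linarith
  | standstill h hrun => exact le_rfl

theorem Config.StepCases.time_le_add {c c' : Config A I} (h : c.StepCases c') {q : Fin I.n}
    (hq : c.running = some q) : c'.time ≤ c.time + (I.proc q - c.work q) := by
  have hw := (running_eq_some.1 hq).2.2
  cases h with
  | release h hr => dsimp only; linarith
  | idle h hr hrun => simp [hrun] at hq
  | work q' hrun h hr hlt =>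
    obtain rfl : q' = q := by simpa [hrun] using hq
    exact hlt.le
  | complete q' hrun hle =>
    obtain rfl : q' = q := by simpa [hrun] using hq
    exact le_rfl
  | standstill h hrun => simp [hrun] at hq

theorem Config.StepCases.work_eq {c c' : Config A I} (h : c.StepCases c') (q : Fin I.n) :
    c'.work q = c.work q + if c.running = some q then c'.time - c.time else 0 := by
  cases h with
  | release h hr => simp
  | idle h hr hrun => simp [hrun]
  | work q' hrun h hr hlt =>
    by_cases hq : q = q'
    · subst hq; simp [hrun]
    · simp [hrun, hq, Ne.symm hq]
  | complete q' hrun hle =>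
    by_cases hq : q = q'
    · subst hq; simp [hrun]
    · simp [hrun, hq, Ne.symm hq]
  | standstill h hrun => simp

open Classical in
/-- A bound on the number of steps until a run stands still. -/
noncomputable def Config.potential (c : Config A I) : ℕ :=
  2 * (I.n - c.arrived) + (Finset.univ.filter fun q => c.work q < I.proc q).card +
    if ∃ h : c.arrived < I.n, c.time < I.release ⟨c.arrived, h⟩ then 1 else 0

/-- An arrival counts twice because it may turn on the indicator of a future release. Steps that
only reach the next release turn the indicator off, and a completion lowers the number of unfinished
jobs. -/
theorem Config.StepCases.potential_lt {c c' : Config A I} (h : c.StepCases c')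
    (hc : c.arrived < I.n ∨ c.running ≠ none) : c'.potential < c.potential := by
  unfold potential
  cases h with
  | release h hr => dsimp only; split_ifs <;> omega
  | idle h hr hrun =>
    dsimp only
    rw [if_neg, if_pos ⟨h, hr⟩]
    · omega
    · simp
  | work q hrun h hr hlt =>
    dsimp only
    rw [if_neg, if_pos ⟨h, hr⟩]
    · refine Nat.add_lt_add_of_le_of_lt (Nat.add_le_add_left (Finset.card_le_card ?_) _) one_pos
      intro q' hq'
      simp only [Finset.mem_filter, Finset.mem_univ, true_and] at hq' ⊢
      by_cases hqq : q' = q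
      · subst hqq
        exact (running_eq_some.1 hrun).2.2
      · simpa [hqq] using hq'
    · simp
  | complete q hrun hle =>
    have hw := (running_eq_some.1 hrun).2.2
    dsimp only
    refine Nat.add_lt_add_of_lt_of_le (Nat.add_lt_add_left (Finset.card_lt_card ?_) _) ?_
    · refine Finset.ssubset_iff_subset_ne.2 ⟨?_, fun he => ?_⟩
      · intro q' hq'
        simp only [Finset.mem_filter, Finset.mem_univ, true_and] at hq' ⊢
        by_cases hqq : q' = q
        · subst hqq
          exact hw
        · simpa [hqq] using hq'
      · have : q ∈ Finset.univ.filter fun q => c.work q < I.proc q := by simpa using hw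
        rw [← he] at this
        simp at this
    · split_ifs with h1 h2
      · exact le_rfl
      · obtain ⟨h, h1⟩ := h1
        exact absurd ⟨h, by linarith⟩ h2
      · exact zero_le_one
      · exact le_rfl
  | standstill h hrun => simp [h, hrun] at hc

variable (A I)

/-- Every run comes to a standstill. -/
theorem OnlineAlgorithm.exists_final :
    ∃ k, ¬ (A.run I k).arrived < I.n ∧ (A.run I k).running = none := by
  by_contra! h
  have key : ∀ k, (A.run I k).potential + k ≤ (A.run I 0).potential := by
    intro k
    induction k with
    | zero => exact le_rfl
    | succ k ih =>
      have h1 : (A.run I (k + 1)).potential < (A.run I k).potential := by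
        refine (A.run I k).stepCases_step.potential_lt ?_
        by_cases h2 : (A.run I k).arrived < I.n
        · exact Or.inl h2
        · exact Or.inr (h k (not_lt.1 h2))
      omega
  have := key ((A.run I 0).potential + 1)
  omega

theorem OnlineAlgorithm.monotone_time : Monotone fun k => (A.run I k).time :=
  monotone_nat_of_le_succ fun k => (A.run I k).stepCases_step.time_le

theorem OnlineAlgorithm.time_nonneg (k : ℕ) : 0 ≤ (A.run I k).time :=
  A.monotone_time I (Nat.zero_le k)

variable {A I}

theorem OnlineAlgorithm.eq_of_time {k l : ℕ} {s : ℝ} (hk : (A.run I k).time ≤ s)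
    (hk' : s < (A.run I (k + 1)).time) (hl : (A.run I l).time ≤ s)
    (hl' : s < (A.run I (l + 1)).time) : k = l := by
  by_contra h
  rcases Nat.lt_or_gt_of_ne h with h | h
  · have := A.monotone_time I (Nat.succ_le_of_lt h)
    exact absurd (hk'.trans_le (this.trans hl)) (lt_irrefl _)
  · have := A.monotone_time I (Nat.succ_le_of_lt h)
    exact absurd (hl'.trans_le (this.trans hk)) (lt_irrefl _)

theorem OnlineAlgorithm.schedule_eq_some {s : ℝ} {q : Fin I.n} :
    A.schedule I s = some q ↔ ∃ k, (A.run I k).time ≤ s ∧ s < (A.run I (k + 1)).time ∧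
      (A.run I k).running = some q := by
  classical
  unfold OnlineAlgorithm.schedule
  constructor
  · intro h
    split_ifs at h with h1
    exact ⟨_, (Nat.find_spec h1).1, (Nat.find_spec h1).2, h⟩
  · rintro ⟨k, h1, h2, h3⟩
    have h : ∃ k, (A.run I k).time ≤ s ∧ s < (A.run I (k + 1)).time := ⟨k, h1, h2⟩
    rw [dif_pos h, eq_of_time (Nat.find_spec h).1 (Nat.find_spec h).2 h1 h2, h3]

theorem OnlineAlgorithm.measurableSet_schedule (q : Fin I.n) :
    MeasurableSet {s : ℝ | A.schedule I s = some q} := by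
  have : {s : ℝ | A.schedule I s = some q} = ⋃ k, ⋃ _ : (A.run I k).running = some q,
      Ico (A.run I k).time (A.run I (k + 1)).time := by
    ext s
    simp only [mem_ofPred_eq, schedule_eq_some, mem_iUnion, mem_Ico, exists_prop]
    exact exists_congr fun k => by tauto
  rw [this]
  exact MeasurableSet.iUnion fun k => MeasurableSet.iUnion fun _ => measurableSet_Ico

/-- This links the discrete run to the measure-theoretic schedule: each step contributes exactly its
time interval to the running job. -/
theorem OnlineAlgorithm.processed_time (q : Fin I.n) (k : ℕ) :
    (A.schedule I).processed q (A.run I k).time = (A.run I k).work q := by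
  induction k with
  | zero =>
    have : {s : ℝ | 0 ≤ s ∧ s < 0 ∧ A.schedule I s = some q} = ∅ := by
      ext s
      simp only [mem_ofPred_eq, mem_empty_iff_false, iff_false]
      rintro ⟨h, h', -⟩
      linarith
    simp [Schedule.processed, OnlineAlgorithm.run, this]
  | succ k ih =>
    have hk := A.monotone_time I (Nat.le_succ k)
    have h0 := A.time_nonneg I k
    have hw : (A.run I (k + 1)).work q = _ := (A.run I k).stepCases_step.work_eq q
    rw [hw, ← ih]
    unfold Schedule.processed
    by_cases hq : (A.run I k).running = some q
    · have : {s : ℝ | 0 ≤ s ∧ s < (A.run I (k + 1)).time ∧ A.schedule I s = some q} =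
          {s : ℝ | 0 ≤ s ∧ s < (A.run I k).time ∧ A.schedule I s = some q} ∪
            Ico (A.run I k).time (A.run I (k + 1)).time := by
        ext s
        simp only [mem_ofPred_eq, mem_union, mem_Ico]
        constructor
        · rintro ⟨h1, h2, h3⟩
          rcases lt_or_ge s (A.run I k).time with h | h
          · exact Or.inl ⟨h1, h, h3⟩
          · exact Or.inr ⟨h, h2⟩
        · rintro (⟨h1, h2, h3⟩ | ⟨h1, h2⟩)
          · exact ⟨h1, h2.trans_le hk, h3⟩
          · exact ⟨h0.trans h1, h2, schedule_eq_some.2 ⟨k, h1, h2, hq⟩⟩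
      rw [this, measureReal_union _ measurableSet_Ico
        (Schedule.volume_processed_ne_top _ q _) (by simp), if_pos hq]
      · congr 1
        rw [Real.volume_real_Ico_of_le hk]
        rfl
      · rw [Set.disjoint_left]
        rintro s ⟨-, h1, -⟩ ⟨h2, -⟩
        linarith
    · rw [if_neg hq, add_zero]
      congr 1
      ext s
      simp only [mem_ofPred_eq]
      constructor
      · rintro ⟨h1, h2, h3⟩
        refine ⟨h1, ?_, h3⟩
        by_contra h
        obtain ⟨l, hl1, hl2, hl3⟩ := schedule_eq_some.1 h3
        obtain rfl := eq_of_time (not_lt.1 h) h2 hl1 hl2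
        exact hq hl3
      · rintro ⟨h1, h2, h3⟩
        exact ⟨h1, h2.trans_le hk, h3⟩

end Run

/-! ### Invariants of the superbin algorithm -/

theorem Superbin.complete_of_notMem {B : Superbin} {q : ℕ} (hq : q ∉ B.partialBin)
    (hB : B.Balanced) : B.complete q = B := by
  simp only [complete, List.erase_of_not_mem hq]
  exact rebalance_of_le hB.1

variable {μ : ℝ} {pick : SuperbinState → ℤ} {I : Instance}

/-- The superbins in a snapshot of a run of the algorithm. -/
def Config.bins (c : Config (superbinAlgorithm μ pick) I) : SuperbinState := c.state

/-- The remaining processing time of the job with a given number. -/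
noncomputable def Config.rem {A : OnlineAlgorithm} (c : Config A I) (j : ℕ) : ℝ :=
  if h : j < I.n then I.proc ⟨j, h⟩ - c.work ⟨j, h⟩ else 0

@[simp]
theorem Config.rem_val {A : OnlineAlgorithm} (c : Config A I) (q : Fin I.n) :
    c.rem q = I.proc q - c.work q := by
  simp [Config.rem]

/-- The weight class of a job. -/
noncomputable def Instance.cls (I : Instance) (q : Fin I.n) : ℤ := weightClass (I.weight q)

/-- The invariants of a run of the algorithm. -/
structure Config.Valid (c : Config (superbinAlgorithm μ pick) I) : Prop where
  release_le : ∀ q : Fin I.n, q.1 < c.arrived → I.release q ≤ c.time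
  le_release : ∀ q : Fin I.n, c.arrived ≤ q.1 → c.time ≤ I.release q
  work_le : ∀ q, c.work q ≤ I.proc q
  work_eq_zero : ∀ q : Fin I.n, c.arrived ≤ q.1 → c.work q = 0
  nodup : ∀ i, (c.bins i).jobs.Nodup
  mem_jobs : ∀ i j, j ∈ (c.bins i).jobs ↔
    ∃ q : Fin I.n, q.1 = j ∧ q.1 < c.arrived ∧ I.cls q = i ∧ c.work q < I.proc q
  full : ∀ i, ∀ a ∈ (c.bins i).full,
    ∃ q : Fin I.n, q.1 = a.1 ∧ I.pred q = a.2 ∧ c.work q = 0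
  balanced : ∀ i, (c.bins i).Balanced

namespace Config

variable {c c' : Config (superbinAlgorithm μ pick) I} {q : Fin I.n}

theorem exists_partialBin_eq (hrun : c.running = some q) :
    ∃ L, (c.bins (pick c.bins)).partialBin = L ++ [q.1] :=
  List.getLast?_eq_some_iff.1 (running_eq_some.1 hrun).1

theorem Valid.rem_nonneg (hc : c.Valid) (j : ℕ) : 0 ≤ c.rem j := by
  unfold Config.rem
  split_ifs with h
  · exact sub_nonneg.2 (hc.work_le _)
  · exact le_rfl

section Running

variable {L : List ℕ}

theorem Valid.notMem_of_eq (hc : c.Valid) (hL : (c.bins (pick c.bins)).partialBin = L ++ [q.1]) :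
    q.1 ∉ L := by
  have h := (List.nodup_append.1 (hc.nodup (pick c.bins))).2.1
  rw [hL] at h
  intro hq
  exact (List.nodup_append.1 h).2.2 _ hq _ (by simp) rfl

theorem Valid.cls_of_eq (hc : c.Valid) (hL : (c.bins (pick c.bins)).partialBin = L ++ [q.1]) :
    I.cls q = pick c.bins := by
  obtain ⟨q', h1, -, h2, -⟩ := (hc.mem_jobs (pick c.bins) q.1).1 (by simp [Superbin.jobs, hL])
  rwa [Fin.ext h1] at h2

theorem Valid.fst_ne_of_mem_full (hc : c.Valid)
    (hL : (c.bins (pick c.bins)).partialBin = L ++ [q.1]) {i : ℤ} {a : ℕ × ℝ}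
    (ha : a ∈ (c.bins i).full) : a.1 ≠ q.1 := by
  intro h
  have h1 : a.1 ∈ (c.bins i).full.map Prod.fst := List.mem_map_of_mem ha
  obtain ⟨q', h2, -, h3, -⟩ := (hc.mem_jobs i a.1).1 (by simp only [Superbin.jobs]; simp [h1])
  obtain rfl : q' = q := Fin.ext (h2.trans h)
  have hi : i = pick c.bins := h3.symm.trans (hc.cls_of_eq hL)
  subst hi
  exact (List.nodup_append.1 (hc.nodup (pick c.bins))).2.2 _ h1 _ (by rw [hL, h]; simp) rfl

/-- A completion is reported to every superbin, but the finished job lies only in the picked one. -/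
theorem Valid.complete_eq_self (hc : c.Valid)
    (hL : (c.bins (pick c.bins)).partialBin = L ++ [q.1]) {i : ℤ} (hi : i ≠ pick c.bins) :
    (c.bins i).complete q = c.bins i := by
  refine Superbin.complete_of_notMem (fun h => hi ?_) (hc.balanced i)
  obtain ⟨q', h2, -, h3, -⟩ := (hc.mem_jobs i q.1).1 (by simp only [Superbin.jobs]; simp [h])
  rw [← h3, Fin.ext h2, hc.cls_of_eq hL]

end Running

/-- Jobs in full bins stay untouched because only the top of a partial bin is ever processed, and no
job moves back to a full bin. -/
theorem Valid.stepCases (hc : c.Valid) (h : c.StepCases c') : c'.Valid := by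
  cases h with
  | standstill h hrun => exact hc
  | idle h hr hrun =>
    exact
      { hc with
        release_le := fun q hq => (hc.release_le q hq).trans hr.le
        le_release := fun q hq => I.release_mono hq }
  | release h hr =>
    set q₀ : Fin I.n := ⟨c.arrived, h⟩ with hq₀
    set c' : Config (superbinAlgorithm μ pick) I := _
    change Valid c'
    have hbins : c'.bins = Function.update c.bins (I.cls q₀)
      ((c.bins (I.cls q₀)).insertJob μ q₀ (I.pred q₀)) := rfl
    have hnot : ∀ i, q₀.1 ∉ (c.bins i).jobs := by
      intro i hi
      obtain ⟨q, h1, h2, -⟩ := (hc.mem_jobs i _).1 hi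
      exact absurd h2 (by rw [h1]; exact lt_irrefl _)
    have htime : c.time = I.release q₀ := le_antisymm (hc.le_release q₀ le_rfl) hr
    have harr : ∀ q : Fin I.n, q.1 < c.arrived + 1 ↔ q.1 < c.arrived ∨ q = q₀ := by
      intro q
      rw [Nat.lt_succ_iff_lt_or_eq, Fin.ext_iff]
    refine ⟨?_, ?_, hc.work_le, ?_, ?_, ?_, ?_, ?_⟩
    · intro q hq
      rcases (harr q).1 hq with h | rfl
      · exact hc.release_le q h
      · exact hr
    · intro q hq
      exact hc.le_release q ((Nat.le_succ _).trans hq)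
    · intro q hq
      exact hc.work_eq_zero q ((Nat.le_succ _).trans hq)
    · intro i
      rw [hbins]
      by_cases hi : i = I.cls q₀
      · subst hi
        rw [Function.update_self, (Superbin.jobs_insertJob_perm _ _ _ _).nodup_iff,
          List.nodup_cons]
        exact ⟨hnot _, hc.nodup _⟩
      · rw [Function.update_of_ne hi]
        exact hc.nodup i
    · intro i j
      have hw : c.work q₀ < I.proc q₀ := by
        rw [hc.work_eq_zero q₀ le_rfl]
        exact I.proc_pos q₀
      have : (∃ q : Fin I.n, q.1 = j ∧ q.1 < c'.arrived ∧ I.cls q = i ∧ c'.work q < I.proc q) ↔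
          (q₀.1 = j ∧ I.cls q₀ = i) ∨ j ∈ (c.bins i).jobs := by
        rw [hc.mem_jobs]
        constructor
        · rintro ⟨q, h1, h2, h3, h4⟩
          rcases (harr q).1 h2 with h | rfl
          · exact Or.inr ⟨q, h1, h, h3, h4⟩
          · exact Or.inl ⟨h1, h3⟩
        · rintro (⟨h1, h2⟩ | ⟨q, h1, h2, h3, h4⟩)
          · exact ⟨q₀, h1, (harr _).2 (Or.inr rfl), h2, hw⟩
          · exact ⟨q, h1, (harr _).2 (Or.inl h2), h3, h4⟩
      rw [this, hbins]
      by_cases hi : i = I.cls q₀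
      · subst hi
        rw [Function.update_self, (Superbin.jobs_insertJob_perm _ _ _ _).mem_iff,
          List.mem_cons]
        simp [eq_comm]
      · rw [Function.update_of_ne hi]
        simp [Ne.symm hi]
    · intro i a ha
      rw [hbins] at ha
      by_cases hi : i = I.cls q₀
      · subst hi
        rw [Function.update_self] at ha
        rcases Superbin.mem_full_of_mem_insertJob ha with rfl | ha
        · exact ⟨q₀, rfl, rfl, hc.work_eq_zero q₀ le_rfl⟩
        · exact hc.full _ a ha
      · rw [Function.update_of_ne hi] at ha
        exact hc.full i a ha
    · intro i
      rw [hbins]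
      by_cases hi : i = I.cls q₀
      · subst hi
        rw [Function.update_self]
        exact (hc.balanced _).insertJob _ _ _
      · rw [Function.update_of_ne hi]
        exact hc.balanced i
  | work q₀ hrun h hr hlt =>
    have hrun' := running_eq_some.1 hrun
    obtain ⟨L, hL⟩ := exists_partialBin_eq hrun
    refine ⟨?_, ?_, ?_, ?_, hc.nodup, ?_, ?_, hc.balanced⟩
    · exact fun q hq => (hc.release_le q hq).trans hr.le
    · exact fun q hq => I.release_mono hq
    · intro q
      by_cases hq : q = q₀
      · subst hq
        simp only [Function.update_self]
        linarith
      · simpa [hq] using hc.work_le q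
    · intro q hq
      have : q ≠ q₀ := by
        rintro rfl
        exact absurd hrun'.2.1 (not_lt.2 hq)
      simpa [this] using hc.work_eq_zero q hq
    · intro i j
      refine (hc.mem_jobs i j).trans (exists_congr fun q => ?_)
      have : Function.update c.work q₀ (c.work q₀ + (I.release ⟨c.arrived, h⟩ - c.time)) q <
          I.proc q ↔ c.work q < I.proc q := by
        by_cases hq : q = q₀
        · subst hq
          simp only [Function.update_self]
          exact ⟨fun _ => hrun'.2.2, fun _ => by linarith⟩
        · simp [hq]
      dsimp only
      rw [this]
    · intro i a ha
      obtain ⟨q, h1, h2, h3⟩ := hc.full i a ha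
      refine ⟨q, h1, h2, ?_⟩
      have : q ≠ q₀ := by
        rintro rfl
        exact hc.fst_ne_of_mem_full hL ha h1.symm
      simpa [this] using h3
  | complete q₀ hrun hle =>
    have hrun' := running_eq_some.1 hrun
    obtain ⟨L, hL⟩ := exists_partialBin_eq hrun
    have hqL := hc.notMem_of_eq hL
    have hcls := hc.cls_of_eq hL
    set c' : Config (superbinAlgorithm μ pick) I := _
    change Valid c'
    have hbins : ∀ i, c'.bins i = (c.bins i).complete q₀ := fun i => rfl
    have hperm : ∀ i, i = pick c.bins → (q₀.1 :: ((c.bins i).complete q₀).jobs).Perm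
        (c.bins i).jobs := by
      rintro i rfl
      exact Superbin.jobs_complete_perm hL hqL
    refine ⟨?_, ?_, ?_, ?_, ?_, ?_, ?_, ?_⟩
    · intro q hq
      refine (hc.release_le q hq).trans ?_
      change c.time ≤ c.time + (I.proc q₀ - c.work q₀)
      linarith
    · intro q hq
      have h : c.arrived < I.n := lt_of_le_of_lt hq q.2
      exact (hle h).trans (I.release_mono hq)
    · intro q
      by_cases hq : q = q₀
      · subst hq
        simp [c']
      · simpa [c', hq] using hc.work_le q
    · intro q hq
      have : q ≠ q₀ := by
        rintro rfl
        exact absurd hrun'.2.1 (not_lt.2 hq)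
      simpa [c', this] using hc.work_eq_zero q hq
    · intro i
      rw [hbins]
      by_cases hi : i = pick c.bins
      · exact (List.nodup_cons.1 ((hperm i hi).nodup_iff.2 (hc.nodup i))).2
      · rw [hc.complete_eq_self hL hi]
        exact hc.nodup i
    · intro i j
      have h1 : (∃ q : Fin I.n, q.1 = j ∧ q.1 < c'.arrived ∧ I.cls q = i ∧
          c'.work q < I.proc q) ↔ j ≠ q₀.1 ∧ j ∈ (c.bins i).jobs := by
        rw [hc.mem_jobs]
        constructor
        · rintro ⟨q, rfl, h2, h3, h4⟩
          have hq : q ≠ q₀ := by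
            rintro rfl
            simp [c'] at h4
          exact ⟨fun h => hq (Fin.ext h), q, rfl, h2, h3, by simpa [c', hq] using h4⟩
        · rintro ⟨hj, q, rfl, h2, h3, h4⟩
          have hq : q ≠ q₀ := by
            rintro rfl
            exact hj rfl
          exact ⟨q, rfl, h2, h3, by simpa [c', hq] using h4⟩
      rw [h1, hbins]
      by_cases hi : i = pick c.bins
      · have hnd := (List.nodup_cons.1 ((hperm i hi).nodup_iff.2 (hc.nodup i))).1
        rw [← (hperm i hi).mem_iff, List.mem_cons]
        constructor
        · intro h
          exact ⟨by rintro rfl; exact hnd h, Or.inr h⟩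
        · rintro ⟨h2, h3 | h3⟩
          · exact absurd h3 h2
          · exact h3
      · rw [hc.complete_eq_self hL hi]
        refine ⟨fun h => ⟨?_, h⟩, fun h => h.2⟩
        rintro rfl
        obtain ⟨q, h3, -, h4, -⟩ := (hc.mem_jobs i _).1 h
        exact hi (by rw [← h4, Fin.ext h3, hcls])
    · intro i a ha
      have ha' : a ∈ (c.bins i).full := Superbin.mem_full_of_mem_complete ha
      obtain ⟨q, h1, h2, h3⟩ := hc.full i a ha'
      refine ⟨q, h1, h2, ?_⟩
      have : q ≠ q₀ := by
        rintro rfl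
        exact hc.fst_ne_of_mem_full hL ha' h1.symm
      simpa [c', this] using h3
    · intro i
      rw [hbins]
      by_cases hi : i = pick c.bins
      · subst hi
        exact (hc.balanced _).complete hL hqL
      · rw [hc.complete_eq_self hL hi]
        exact hc.balanced i

end Config

theorem valid_run (μ : ℝ) (pick : SuperbinState → ℤ) (I : Instance) (k : ℕ) :
    ((superbinAlgorithm μ pick).run I k).Valid := by
  induction k with
  | zero =>
    have hb : ∀ i, Config.bins ((superbinAlgorithm μ pick).run I 0) i =
      { full := [], partialBin := [] } := fun i => rfl
    refine ⟨?_, ?_, ?_, ?_, ?_, ?_, ?_, ?_⟩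
    · exact fun q hq => absurd hq (Nat.not_lt_zero _)
    · exact fun q _ => I.release_nonneg q
    · exact fun q => (I.proc_pos q).le
    · exact fun q _ => rfl
    · intro i; simp [hb, Superbin.jobs]
    · intro i j
      have h0 : ((superbinAlgorithm μ pick).run I 0).arrived = 0 := rfl
      simp [hb, Superbin.jobs, h0]
    · intro i a ha
      simp [hb] at ha
    · intro i; simp [hb, Superbin.Balanced]
  | succ k ih => exact ih.stepCases (Config.stepCases_step _)

/-! ### The heaviest partial bin and completion of all jobs -/

section Heaviest

variable {c : Config (superbinAlgorithm μ pick) I}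

theorem Config.Valid.exists_cls_eq (hc : c.Valid) {i : ℤ} (hi : (c.bins i).partialBin ≠ []) :
    ∃ q, I.cls q = i := by
  obtain ⟨j, hj⟩ := List.exists_mem_of_ne_nil _ hi
  obtain ⟨q, -, -, h, -⟩ := (hc.mem_jobs i j).1 (by simp only [Superbin.jobs]; simp [hj])
  exact ⟨q, h⟩

theorem partialWeight_nonneg (s : SuperbinState) (i : ℤ) : 0 ≤ partialWeight s i := by
  unfold partialWeight
  positivity

theorem Config.Valid.partialWeight_le_pick (hc : c.Valid) (hpick : PicksHeaviest pick) (j : ℤ) :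
    partialWeight c.bins j ≤ partialWeight c.bins (pick c.bins) := by
  refine hpick c.bins ?_ j
  -- Only the finitely many classes of jobs can have a nonempty bin, so a maximum exists and the
  -- hypothesis on `pick` applies.
  have hz : ∀ i, (∀ q, I.cls q ≠ i) → partialWeight c.bins i = 0 := by
    intro i hi
    have : (c.bins i).partialBin = [] := by
      by_contra h
      obtain ⟨q, hq⟩ := hc.exists_cls_eq h
      exact hi q hq
    simp [partialWeight, this]
  rcases isEmpty_or_nonempty (Fin I.n) with he | he
  · exact ⟨0, fun j => by rw [hz j he.elim, hz 0 he.elim]⟩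
  · obtain ⟨q, hq⟩ := Finite.exists_max fun q => partialWeight c.bins (I.cls q)
    refine ⟨I.cls q, fun j => ?_⟩
    by_cases h : ∃ q', I.cls q' = j
    · obtain ⟨q', rfl⟩ := h
      exact hq q'
    · rw [hz j (by simpa using h)]
      exact partialWeight_nonneg _ _

/-- If some partial bin is nonempty, then a job in a heaviest partial bin is running. -/
theorem Config.Valid.exists_running (hc : c.Valid) (hpick : PicksHeaviest pick) {i : ℤ}
    (hi : 0 < partialWeight c.bins i) :
    ∃ q L, c.running = some q ∧ (c.bins (pick c.bins)).partialBin = L ++ [q.1] := by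
  have h := hi.trans_le (hc.partialWeight_le_pick hpick i)
  have hne : (c.bins (pick c.bins)).partialBin ≠ [] := by
    intro h0
    simp [partialWeight, h0] at h
  obtain ⟨L, j, hL⟩ : ∃ L j, (c.bins (pick c.bins)).partialBin = L ++ [j] := by
    rcases List.eq_nil_or_concat (c.bins (pick c.bins)).partialBin with h0 | ⟨L, j, h0⟩
    · exact absurd h0 hne
    · exact ⟨L, j, by simpa using h0⟩
  obtain ⟨q, rfl, h1, -, h2⟩ := (hc.mem_jobs (pick c.bins) j).1 (by simp [Superbin.jobs, hL])
  refine ⟨q, L, running_eq_some.2 ⟨?_, h1, h2⟩, hL⟩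
  exact List.getLast?_eq_some_iff.2 ⟨L, hL⟩

end Heaviest

/-- The algorithm completes all jobs. -/
theorem exists_work_eq_proc (hpick : PicksHeaviest pick) (I : Instance) :
    ∃ k, ∀ q, ((superbinAlgorithm μ pick).run I k).work q = I.proc q := by
  obtain ⟨k, h1, h2⟩ := (superbinAlgorithm μ pick).exists_final I
  have hc := valid_run μ pick I k
  refine ⟨k, fun q => le_antisymm (hc.work_le q) ?_⟩
  by_contra! h
  have hmem := (hc.mem_jobs (I.cls q) q).2 ⟨q, rfl, q.2.trans_le (not_lt.1 h1), rfl, h⟩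
  -- A full bin is no longer than its partial bin, so a pending job forces the partial bin to be
  -- nonempty.
  have hne : (((superbinAlgorithm μ pick).run I k).bins (I.cls q)).partialBin ≠ [] := by
    intro h0
    have h3 := (hc.balanced (I.cls q)).1
    simp only [h0, List.length_nil, Nat.le_zero, List.length_eq_zero_iff] at h3
    simp [Superbin.jobs, h0, h3] at hmem
  have hpos : 0 < partialWeight ((superbinAlgorithm μ pick).run I k).bins (I.cls q) := by
    have := List.length_pos_iff.2 hne
    unfold partialWeight
    positivity
  obtain ⟨q', L, h3, -⟩ := hc.exists_running hpick hpos
  simp [h3] at h2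

theorem feasible_schedule (hpick : PicksHeaviest pick) (I : Instance) :
    I.Feasible ((superbinAlgorithm μ pick).schedule I) where
  measurable := OnlineAlgorithm.measurableSet_schedule
  released := by
    intro s q hs
    obtain ⟨k, h1, -, h2⟩ := OnlineAlgorithm.schedule_eq_some.1 hs
    exact ((valid_run μ pick I k).release_le q (Config.running_eq_some.1 h2).2.1).trans h1
  completed := by
    intro q
    obtain ⟨k, hk⟩ := exists_work_eq_proc (μ := μ) hpick I
    exact ⟨_, ((OnlineAlgorithm.processed_time q k).trans (hk q)).ge⟩

/-! ### The volume invariant -/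

/-- The weight classes of the jobs of an instance. -/
noncomputable def Instance.classes (I : Instance) : Finset ℤ := Finset.univ.image I.cls

theorem Instance.cls_mem_classes (I : Instance) (q : Fin I.n) : I.cls q ∈ I.classes :=
  Finset.mem_image_of_mem _ (Finset.mem_univ _)

open Classical in
/-- The rounded weight of the arrived jobs of a set. -/
noncomputable def Config.load {A : OnlineAlgorithm} (c : Config A I) (O : Set (Fin I.n)) : ℝ :=
  ∑ q : Fin I.n, if q ∈ O ∧ q.1 < c.arrived then (2 : ℝ) ^ I.cls q else 0

open Classical in
/-- The time that a schedule still needs for the arrived jobs outside a set. -/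
noncomputable def Config.residual {A : OnlineAlgorithm} (c : Config A I) (O : Set (Fin I.n))
    (S : Schedule I.n) (t : ℝ) : ℝ :=
  ∑ q : Fin I.n, if q ∉ O ∧ q.1 < c.arrived then max 0 (I.proc q - S.processed q t) else 0

/-- The position in the bins of the `i`-th superbin up to which jobs are charged to `O`. -/
noncomputable def Config.threshold {A : OnlineAlgorithm} (c : Config A I) (N : ℕ)
    (O : Set (Fin I.n)) (i : ℤ) : ℕ :=
  ⌊N * c.load O / (2 : ℝ) ^ i⌋₊

/-- The total volume, with respect to `v`, above the thresholds. -/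
noncomputable def totalExcess (I : Instance) (v : ℕ → ℝ) (M : ℤ → ℕ) (s : SuperbinState) : ℝ :=
  ∑ i ∈ I.classes, (s i).excess v (M i)

section TotalExcess

variable {v v' : ℕ → ℝ} {M : ℤ → ℕ} {s : SuperbinState}

theorem totalExcess_nonneg (hv : ∀ j, 0 ≤ v j) : 0 ≤ totalExcess I v M s :=
  Finset.sum_nonneg fun _ _ => Superbin.excess_nonneg hv _

theorem totalExcess_eq_zero (hs : ∀ i, (s i).Balanced) (h : ∀ i, (s i).partialBin.length ≤ M i) :
    totalExcess I v M s = 0 :=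
  Finset.sum_eq_zero fun i _ => Superbin.excess_eq_zero v (h i) (hs i).1

theorem totalExcess_add_le (hle : ∀ j, v' j ≤ v j) {q : Fin I.n} {d : ℝ} (hd : v' q + d ≤ v q)
    {L : List ℕ} (hL : (s (I.cls q)).partialBin = L ++ [q.1])
    (hM : M (I.cls q) < (s (I.cls q)).partialBin.length) :
    totalExcess I v' M s + d ≤ totalExcess I v M s := by
  have h : totalExcess I v' M s + d =
      ∑ i ∈ I.classes, ((s i).excess v' (M i) + if i = I.cls q then d else 0) := by
    rw [Finset.sum_add_distrib, Finset.sum_ite_eq', if_pos (I.cls_mem_classes q), totalExcess]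
  rw [h]
  refine Finset.sum_le_sum fun i _ => ?_
  by_cases hi : i = I.cls q
  · subst hi
    rw [if_pos rfl]
    exact Superbin.excess_add_le_of_lt hle hd hL hM
  · rw [if_neg hi, add_zero]
    exact Superbin.excess_mono hle _ _

end TotalExcess

section Processed

variable {S : Schedule I.n}

/-- A schedule processes at most `t' - t` in the time from `t` to `t'`. -/
theorem Instance.Feasible.sum_processed_le (hS : I.Feasible S) (s : Finset (Fin I.n)) {t t' : ℝ}
    (ht : 0 ≤ t) (h : t ≤ t') :
    ∑ q ∈ s, (S.processed q t' - S.processed q t) ≤ t' - t := by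
  have h1 : ∀ q, S.processed q t' - S.processed q t =
      volume.real (Ico t t' ∩ {x | S x = some q}) := by
    intro q
    have : {x : ℝ | 0 ≤ x ∧ x < t' ∧ S x = some q} =
        {x : ℝ | 0 ≤ x ∧ x < t ∧ S x = some q} ∪ (Ico t t' ∩ {x | S x = some q}) := by
      ext x
      simp only [mem_ofPred_eq, mem_union, mem_inter_iff, mem_Ico]
      constructor
      · rintro ⟨h1, h2, h3⟩
        rcases lt_or_ge x t with h | h
        · exact Or.inl ⟨h1, h, h3⟩
        · exact Or.inr ⟨⟨h, h2⟩, h3⟩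
      · rintro (⟨h1, h2, h3⟩ | ⟨⟨h1, h2⟩, h3⟩)
        · exact ⟨h1, h2.trans_le h, h3⟩
        · exact ⟨ht.trans h1, h2, h3⟩
    unfold Schedule.processed
    rw [this, measureReal_union _ (measurableSet_Ico.inter (hS.measurable q))
      (Schedule.volume_processed_ne_top _ q _)
      (measure_ne_top_of_subset inter_subset_left (by simp))]
    · ring
    · rw [Set.disjoint_left]
      rintro x ⟨-, h1, -⟩ ⟨⟨h2, -⟩, -⟩
      linarith
  simp_rw [h1]
  rw [← measureReal_biUnion_finset ?_ ?_ fun q _ =>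
    measure_ne_top_of_subset inter_subset_left (by simp)]
  · rw [← Real.volume_real_Ico_of_le h]
    exact measureReal_mono (iUnion₂_subset fun q _ => inter_subset_left) (by simp)
  · intro q _ q' _ hqq
    rw [Function.onFun, Set.disjoint_left]
    rintro x ⟨-, h1⟩ ⟨-, h2⟩
    exact hqq (Option.some.inj (h1.symm.trans h2))
  · exact fun q _ => measurableSet_Ico.inter (hS.measurable q)

variable {A : OnlineAlgorithm} (c : Config A I) (O : Set (Fin I.n))

theorem Config.residual_nonneg (S : Schedule I.n) (t : ℝ) : 0 ≤ c.residual O S t := by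
  refine Finset.sum_nonneg fun q _ => ?_
  split_ifs
  · exact le_max_left _ _
  · exact le_rfl

theorem Config.residual_le_add (hS : I.Feasible S) {t t' : ℝ} (ht : 0 ≤ t) (h : t ≤ t') :
    c.residual O S t ≤ c.residual O S t' + (t' - t) := by
  refine le_trans ?_ (add_le_add_right (hS.sum_processed_le Finset.univ ht h) _)
  rw [Config.residual, Config.residual, ← Finset.sum_add_distrib]
  refine Finset.sum_le_sum fun q _ => ?_
  have := S.processed_mono q h
  split_ifs
  · refine max_le ?_ ?_
    · have := le_max_left 0 (I.proc q - S.processed q t')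
      linarith
    · have := le_max_right 0 (I.proc q - S.processed q t')
      linarith
  · linarith

theorem Config.load_nonneg : 0 ≤ c.load O := by
  refine Finset.sum_nonneg fun q _ => ?_
  split_ifs <;> positivity

end Processed

section Threshold

variable {c c' : Config (superbinAlgorithm μ pick) I} {N : ℕ} {O : Set (Fin I.n)}

/-- In terms of weight the threshold does not depend on the class; this is why processing the
heaviest partial bin is the right choice. -/
theorem Config.threshold_lt_iff {i : ℤ} :
    c.threshold N O i < (c.bins i).partialBin.length ↔ N * c.load O < partialWeight c.bins i := by
  have h2 : (0 : ℝ) < 2 ^ i := by positivity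
  have := c.load_nonneg O
  rw [Config.threshold, Nat.floor_lt (by positivity), div_lt_iff₀ h2, partialWeight]

theorem Config.Valid.exists_running_of_threshold_lt (hc : c.Valid) (hpick : PicksHeaviest pick)
    {i : ℤ} (hi : c.threshold N O i < (c.bins i).partialBin.length) :
    ∃ q L, c.running = some q ∧ (c.bins (I.cls q)).partialBin = L ++ [q.1] ∧
      c.threshold N O (I.cls q) < (c.bins (I.cls q)).partialBin.length := by
  rw [threshold_lt_iff] at hi
  have := c.load_nonneg O
  obtain ⟨q, L, h1, h2⟩ :=
    hc.exists_running hpick (lt_of_le_of_lt (by positivity) hi)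
  have h3 := hc.cls_of_eq h2
  refine ⟨q, L, h1, by rw [h3]; exact h2, ?_⟩
  rw [threshold_lt_iff, h3]
  exact hi.trans_le (hc.partialWeight_le_pick hpick i)

variable {S : Schedule I.n}

/-- Common to all steps without a release: either the running job is above its threshold and its
progress pays for that of `S`, or the excess is zero. The hypothesis `hE'` covers the change of the
bins at a completion. -/
theorem Config.excess_le_residual_of_processed (hc : c.Valid) (hpick : PicksHeaviest pick)
    (hS : I.Feasible S) (h : c.StepCases c') (harr : c'.arrived = c.arrived)
    (hc0 : 0 ≤ c.time)
    (hE : totalExcess I c.rem (c.threshold N O) c.bins ≤ c.residual O S c.time)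
    (hE' : totalExcess I c'.rem (c'.threshold N O) c'.bins ≤
      totalExcess I c'.rem (c.threshold N O) c.bins) :
    totalExcess I c'.rem (c'.threshold N O) c'.bins ≤ c'.residual O S c'.time := by
  classical
  refine hE'.trans ?_
  have hres : ∀ t, c'.residual O S t = c.residual O S t := by
    intro t
    exact Finset.sum_congr rfl fun q _ => if_congr (by rw [harr]) rfl rfl
  rw [hres]
  by_cases hex : ∃ i, c.threshold N O i < (c.bins i).partialBin.length
  · obtain ⟨i, hi⟩ := hex
    obtain ⟨q, L, h1, h2, h3⟩ := hc.exists_running_of_threshold_lt hpick hi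
    have hle : ∀ j, c'.rem j ≤ c.rem j := by
      intro j
      unfold Config.rem
      split_ifs with hj
      · rw [h.work_eq]
        have := h.time_le
        split_ifs <;> linarith
      · exact le_rfl
    have hd : c'.rem q + (c'.time - c.time) ≤ c.rem q := by
      simp only [rem_val, h.work_eq, h1, if_true]
      linarith
    have := totalExcess_add_le hle hd h2 h3
    have := c.residual_le_add O hS hc0 h.time_le
    linarith
  · push Not at hex
    rw [totalExcess_eq_zero hc.balanced hex]
    exact c.residual_nonneg O S _

theorem Config.excess_le_residual_of_stepCases (hc : c.Valid) (hpick : PicksHeaviest pick)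
    (hS : I.Feasible S) (hμ : 1 < μ) (hN : μ ^ 2 ≤ N) (hI : I.HasDistortion μ)
    (h : c.StepCases c') (hc0 : 0 ≤ c.time)
    (hE : totalExcess I c.rem (c.threshold N O) c.bins ≤ c.residual O S c.time) :
    totalExcess I c'.rem (c'.threshold N O) c'.bins ≤ c'.residual O S c'.time := by
  classical
  have hc' := hc.stepCases h
  cases h with
  | standstill h hrun => exact hE
  | idle h hr hrun =>
    exact excess_le_residual_of_processed hc hpick hS (.idle h hr hrun) rfl hc0 hE le_rfl
  | work q hrun h hr hlt =>
    exact excess_le_residual_of_processed hc hpick hS (.work q hrun h hr hlt) rfl hc0 hE le_rfl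
  | complete q hrun hle =>
    refine excess_le_residual_of_processed hc hpick hS (.complete q hrun hle) rfl hc0 hE ?_
    refine Finset.sum_le_sum fun i _ => ?_
    obtain ⟨L, hL⟩ := exists_partialBin_eq hrun
    change ((c.bins i).complete q).excess _ _ ≤ _
    by_cases hi : i = pick c.bins
    · subst hi
      exact Superbin.excess_complete_le hc'.rem_nonneg (hc.balanced _) hL (hc.notMem_of_eq hL) _
    · rw [hc.complete_eq_self hL hi]
      exact le_rfl
  | release h hr =>
    set q₀ : Fin I.n := ⟨c.arrived, h⟩ with hq₀
    set c' : Config (superbinAlgorithm μ pick) I := _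
    change totalExcess I c.rem (c'.threshold N O) c'.bins ≤ c'.residual O S c.time
    have hbins : c'.bins = Function.update c.bins (I.cls q₀)
      ((c.bins (I.cls q₀)).insertJob μ q₀ (I.pred q₀)) := rfl
    -- Jobs are handed over exactly at their release, so `S` has not yet worked on `q₀`.
    have htime : c.time = I.release q₀ := le_antisymm (hc.le_release q₀ le_rfl) hr
    have harr : ∀ q : Fin I.n, q.1 < c'.arrived ↔ q.1 < c.arrived ∨ q = q₀ := by
      intro q
      rw [Fin.ext_iff]
      exact Nat.lt_succ_iff_lt_or_eq
    have hq₀' : ¬ q₀.1 < c.arrived := lt_irrefl _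
    have hrem : c.rem q₀ = I.proc q₀ := by
      rw [rem_val, hc.work_eq_zero q₀ le_rfl, sub_zero]
    have hfull : ∀ i, ∀ a ∈ (c.bins i).full, ∃ q, I.pred q = a.2 ∧ c.rem a.1 = I.proc q := by
      intro i a ha
      obtain ⟨q, h1, h2, h3⟩ := hc.full i a ha
      exact ⟨q, h2, by rw [← h1, rem_val, h3, sub_zero]⟩
    -- A violation certifies an inequality of real sizes: `p_a < μ * pred a ≤ pred q₀ ≤ p_{q₀}`.
    have hbad : ∀ a ∈ (c.bins (I.cls q₀)).full, μ * a.2 ≤ I.pred q₀ → c.rem a.1 ≤ c.rem q₀ := by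
      intro a ha hle
      obtain ⟨q, h1, h2⟩ := hfull _ a ha
      rw [h2, hrem]
      rw [← h1] at hle
      exact (hI q).2.le.trans (hle.trans (hI q₀).1)
    by_cases hO : q₀ ∈ O
    · have hres : c'.residual O S c.time = c.residual O S c.time := by
        refine Finset.sum_congr rfl fun q _ => ?_
        refine if_congr ?_ rfl rfl
        rw [harr]
        refine and_congr_right fun hq => or_iff_left ?_
        rintro rfl
        exact hq hO
      have hload : c'.load O = c.load O + 2 ^ I.cls q₀ := by
        have h1 : ∑ q, (if q = q₀ then (2 : ℝ) ^ I.cls q else 0) = 2 ^ I.cls q₀ := by simp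
        rw [← h1, Config.load, Config.load, ← Finset.sum_add_distrib]
        refine Finset.sum_congr rfl fun q _ => ?_
        simp only [harr]
        by_cases hq : q = q₀
        · subst hq
          simp [hO, hq₀']
        · simp [hq]
      rw [hres]
      refine le_trans (Finset.sum_le_sum fun i _ => ?_) hE
      have h0 := c.load_nonneg O
      rw [hbins]
      by_cases hi : i = I.cls q₀
      · subst hi
        have hM : c'.threshold N O (I.cls q₀) = c.threshold N O (I.cls q₀) + N := by
          rw [Config.threshold, Config.threshold, hload, mul_add, add_div,
            mul_div_cancel_right₀ _ (by positivity : (2 : ℝ) ^ I.cls q₀ ≠ 0)]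
          exact Nat.floor_add_natCast (by positivity) N
        rw [Function.update_self, hM]
        have hμ2 : 0 < μ ^ 2 := by positivity
        -- A job `a` not in violation satisfies `p_{q₀} < μ * pred q₀ < μ ^ 2 * pred a ≤ μ ^ 2 *
        -- p_a`; this gives `δ`, and `μ ^ 2 ≤ N` makes `N * δ` at least the size of `q₀`.
        refine Superbin.excess_add_insertJob_le hc.rem_nonneg (hc.balanced _) hbad
          (δ := I.proc q₀ / μ ^ 2) (div_nonneg (I.proc_pos q₀).le hμ2.le) ?_ ?_ _
        · rw [hrem, mul_div_assoc', le_div_iff₀ hμ2, mul_comm]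
          exact mul_le_mul_of_nonneg_right hN (I.proc_pos q₀).le
        · intro a ha hlt
          obtain ⟨q, h1, h2⟩ := hfull _ a ha
          rw [h2, div_le_iff₀ hμ2]
          rw [← h1, not_le] at hlt
          have h3 := (hI q₀).2
          have h4 := (hI q).1
          have h5 : μ * I.pred q₀ ≤ μ * (μ * I.proc q) := by gcongr; nlinarith
          nlinarith
      · rw [Function.update_of_ne hi]
        -- In the other classes only the threshold moves, and it moves up.
        refine Superbin.excess_anti hc.rem_nonneg (Nat.floor_mono ?_)
        rw [hload]
        have : (0 : ℝ) < 2 ^ I.cls q₀ := by positivity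
        gcongr
        linarith
    · have hload : c'.load O = c.load O := by
        refine Finset.sum_congr rfl fun q _ => ?_
        refine if_congr ?_ rfl rfl
        rw [harr]
        refine and_congr_right fun hq => or_iff_left ?_
        rintro rfl
        exact hO hq
      have hM : c'.threshold N O = c.threshold N O := by
        funext i
        rw [Config.threshold, Config.threshold, hload]
      have hres : c'.residual O S c.time = c.residual O S c.time + I.proc q₀ := by
        have h1 : ∑ q, (if q = q₀ then I.proc q else 0) = I.proc q₀ := by simp
        rw [← h1, Config.residual, Config.residual, ← Finset.sum_add_distrib]
        refine Finset.sum_congr rfl fun q _ => ?_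
        simp only [harr]
        by_cases hq : q = q₀
        · subst hq
          simp [hO, hq₀', hS.processed_eq_zero htime.le, (I.proc_pos q₀).le]
        · simp [hq]
      rw [hres, hM]
      refine le_trans ?_ (add_le_add_left hE _)
      have h1 : totalExcess I c.rem (c.threshold N O) c.bins + I.proc q₀ =
          ∑ i ∈ I.classes, ((c.bins i).excess c.rem (c.threshold N O i) +
            if i = I.cls q₀ then I.proc q₀ else 0) := by
        rw [Finset.sum_add_distrib, Finset.sum_ite_eq', if_pos (I.cls_mem_classes q₀), totalExcess]
      rw [h1, hbins]
      refine Finset.sum_le_sum fun i _ => ?_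
      by_cases hi : i = I.cls q₀
      · subst hi
        rw [Function.update_self, if_pos rfl, ← hrem]
        exact Superbin.excess_insertJob_le hc.rem_nonneg (hc.balanced _) hbad _
      · rw [Function.update_of_ne hi, if_neg hi, add_zero]

theorem excess_le_residual (hpick : PicksHeaviest pick)
    (hS : I.Feasible S) (hμ : 1 < μ) (hN : μ ^ 2 ≤ N) (hI : I.HasDistortion μ)
    (O : Set (Fin I.n)) (k : ℕ) :
    totalExcess I ((superbinAlgorithm μ pick).run I k).rem
      (((superbinAlgorithm μ pick).run I k).threshold N O)
      ((superbinAlgorithm μ pick).run I k).bins ≤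
    ((superbinAlgorithm μ pick).run I k).residual O S ((superbinAlgorithm μ pick).run I k).time := by
  induction k with
  | zero =>
    rw [totalExcess_eq_zero (valid_run μ pick I 0).balanced fun i => Nat.zero_le _]
    exact Config.residual_nonneg _ _ _ _
  | succ k ih =>
    exact Config.excess_le_residual_of_stepCases (valid_run μ pick I k) hpick hS hμ hN hI
      (Config.stepCases_step _) (OnlineAlgorithm.time_nonneg _ _ _) ih

/-- Every partial bin is charged to the jobs that are unfinished in the schedule `S`. -/
theorem length_partialBin_le (hpick : PicksHeaviest pick)
    (hS : I.Feasible S) (hμ : 1 < μ) (hN : μ ^ 2 ≤ N) (hI : I.HasDistortion μ) {k : ℕ} {t : ℝ}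
    (hk : ((superbinAlgorithm μ pick).run I k).time ≤ t)
    (hk' : t < ((superbinAlgorithm μ pick).run I (k + 1)).time) (i : ℤ) :
    (((superbinAlgorithm μ pick).run I k).bins i).partialBin.length ≤
      ((superbinAlgorithm μ pick).run I k).threshold N
        {q | I.release q ≤ t ∧ t ≤ I.completionTime S q} i := by
  classical
  by_contra! hi
  set O : Set (Fin I.n) := {q | I.release q ≤ t ∧ t ≤ I.completionTime S q} with hO
  set c := (superbinAlgorithm μ pick).run I k with hck
  have hc : c.Valid := valid_run μ pick I k
  obtain ⟨q, L, h1, h2, h3⟩ := hc.exists_running_of_threshold_lt hpick hi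
  have hE := excess_le_residual hpick hS hμ hN hI O k
  rw [← hck] at hE
  -- Every arrived job outside `O` was completed by `S` before `t`.
  have hres0 : c.residual O S t = 0 := by
    refine Finset.sum_eq_zero fun q' _ => ?_
    split_ifs with hq'
    · have hr := (hc.release_le q' hq'.2).trans hk
      have hlt : I.completionTime S q' < t := by
        by_contra! h
        exact hq'.1 ⟨hr, h⟩
      exact max_eq_left (sub_nonpos.2 (hS.le_processed_of_lt hlt))
    · rfl
  have hres := c.residual_le_add O hS (OnlineAlgorithm.time_nonneg _ I k) hk
  have hstep : ((superbinAlgorithm μ pick).run I (k + 1)).time ≤ _ :=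
    (Config.stepCases_step c).time_le_add h1
  -- Setting the remaining time of `q` to zero shows that the excess is at least that remaining
  -- time. It is more than `t - c.time`, since the step ends after `t`, whereas the residual at
  -- `c.time` is at most `t - c.time`.
  have hv : ∀ j, 0 ≤ Function.update c.rem q 0 j := by
    intro j
    by_cases hj : j = q.1
    · simp [hj]
    · simpa [hj] using hc.rem_nonneg j
  have hle : ∀ j, Function.update c.rem q 0 j ≤ c.rem j := by
    intro j
    by_cases hj : j = q.1
    · subst hj
      simpa using hc.work_le q
    · simp [hj]
  have hex := totalExcess_add_le (M := c.threshold N O) hle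
    (d := c.rem q) (by simp) h2 h3
  have h0 := totalExcess_nonneg (I := I) (M := c.threshold N O) (s := c.bins) hv
  rw [Config.rem_val] at hex
  linarith

end Threshold

/-! ### Weight classes and integration over time -/

theorem Instance.weight_le_zpow_cls (I : Instance) (q : Fin I.n) :
    I.weight q ≤ (2 : ℝ) ^ I.cls q := by
  have := Int.self_le_zpow_clog (b := 2) one_lt_two (I.weight q)
  exact_mod_cast this

theorem Instance.zpow_cls_lt (I : Instance) (q : Fin I.n) :
    (2 : ℝ) ^ I.cls q < 2 * I.weight q := by
  have h : ((2 : ℕ) : ℝ) ^ (I.cls q - 1) < I.weight q :=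
    Int.zpow_pred_clog_lt_self one_lt_two (I.weight_pos q)
  rw [Nat.cast_ofNat, zpow_sub_one₀ two_ne_zero] at h
  linarith

/-- The number of weight classes is logarithmic in the weight ratio. -/
theorem Instance.card_classes_le (I : Instance) :
    (I.classes.card : ℝ) ≤ 3 * max 1 (Real.logb 2 I.weightRatio) := by
  rcases isEmpty_or_nonempty (Fin I.n) with he | he
  · have : I.classes = ∅ := by simp [Instance.classes, Finset.univ_eq_empty]
    rw [this, Finset.card_empty, Nat.cast_zero]
    positivity
  obtain ⟨a, ha⟩ := Finite.exists_min I.weight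
  obtain ⟨b, hb⟩ := Finite.exists_max I.weight
  have hW : I.weightRatio = I.weight b / I.weight a := by
    have h1 : ⨆ q, I.weight q = I.weight b :=
      le_antisymm (ciSup_le hb) (le_ciSup (Set.finite_range I.weight).bddAbove b)
    have h2 : ⨅ q, I.weight q = I.weight a :=
      le_antisymm (ciInf_le (Set.finite_range I.weight).bddBelow a) (le_ciInf ha)
    rw [Instance.weightRatio, h1, h2]
  have hmono : ∀ q q', I.weight q ≤ I.weight q' → I.cls q ≤ I.cls q' := fun q q' h =>
    Int.clog_mono_right (I.weight_pos q) h
  have hsub : I.classes ⊆ Finset.Icc (I.cls a) (I.cls b) := by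
    intro i hi
    obtain ⟨q, -, rfl⟩ := Finset.mem_image.1 hi
    exact Finset.mem_Icc.2 ⟨hmono _ _ (ha q), hmono _ _ (hb q)⟩
  have hcard : (I.classes.card : ℝ) ≤ I.cls b - I.cls a + 1 := by
    have h1 := Finset.card_le_card hsub
    rw [Int.card_Icc] at h1
    have h2 := hmono _ _ (ha b)
    have h3 : (I.classes.card : ℤ) ≤ I.cls b + 1 - I.cls a := by omega
    have h4 : ((I.classes.card : ℤ) : ℝ) ≤ ((I.cls b + 1 - I.cls a : ℤ) : ℝ) := by
      exact_mod_cast h3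
    push_cast at h4
    linarith
  have hdiff : ((I.cls b : ℝ) - I.cls a) ≤ 1 + Real.logb 2 I.weightRatio := by
    have h1 : (I.cls b : ℝ) ≤ Real.logb 2 (2 * I.weight b) := by
      rw [Real.le_logb_iff_rpow_le one_lt_two (by linarith [I.weight_pos b]), Real.rpow_intCast]
      exact (I.zpow_cls_lt b).le
    have h2 : Real.logb 2 (I.weight a) ≤ I.cls a := by
      rw [Real.logb_le_iff_le_rpow one_lt_two (I.weight_pos a), Real.rpow_intCast]
      exact I.weight_le_zpow_cls a
    rw [Real.logb_mul two_ne_zero (I.weight_pos b).ne', Real.logb_self_eq_one one_lt_two] at h1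
    rw [hW, Real.logb_div (I.weight_pos b).ne' (I.weight_pos a).ne']
    linarith
  -- There are at most `2 + logb 2 W` classes, where rounding accounts for one of the two extra
  -- units.
  have h1 := le_max_left 1 (Real.logb 2 I.weightRatio)
  have h2 := le_max_right 1 (Real.logb 2 I.weightRatio)
  linarith

/-- The pending weight in terms of the load of `O`, if all partial bins are below the
thresholds. -/
theorem Config.Valid.sum_weight_le {c : Config (superbinAlgorithm μ pick) I} (hc : c.Valid)
    {N : ℕ} {O : Set (Fin I.n)}
    (hP : ∀ i, (c.bins i).partialBin.length ≤ c.threshold N O i) (s : Finset (Fin I.n))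
    (hs : ∀ q ∈ s, q.1 < c.arrived ∧ c.work q < I.proc q) :
    ∑ q ∈ s, I.weight q ≤ I.classes.card * (2 * N * c.load O) := by
  classical
  have h1 : ∑ q ∈ s, I.weight q ≤ ∑ q ∈ s, (2 : ℝ) ^ I.cls q :=
    Finset.sum_le_sum fun q _ => I.weight_le_zpow_cls q
  refine h1.trans ?_
  rw [← Finset.sum_fiberwise_of_maps_to (fun q _ => I.cls_mem_classes q), ← nsmul_eq_mul]
  refine Finset.sum_le_card_nsmul _ _ _ fun i _ => ?_
  have h2 : ∑ q ∈ s with I.cls q = i, (2 : ℝ) ^ I.cls q =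
      (s.filter fun q => I.cls q = i).card * (2 : ℝ) ^ i := by
    rw [← nsmul_eq_mul, ← Finset.sum_const]
    exact Finset.sum_congr rfl fun q hq => by rw [(Finset.mem_filter.1 hq).2]
  have h3 : (s.filter fun q => I.cls q = i).card ≤ (c.bins i).jobs.length := by
    refine le_trans ?_ (List.toFinset_card_le _)
    refine Finset.card_le_card_of_injOn Fin.val ?_ (Fin.val_injective.injOn)
    intro q hq
    obtain ⟨h4, h5⟩ := Finset.mem_filter.1 (Finset.mem_coe.1 hq)
    exact Finset.mem_coe.2
      (List.mem_toFinset.2 ((hc.mem_jobs i q).2 ⟨q, rfl, (hs q h4).1, h5, (hs q h4).2⟩))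
  -- The factor 2 counts both bins, as the full one is no longer than the partial one.
  have h4 : (c.bins i).jobs.length ≤ 2 * c.threshold N O i := by
    have := hP i
    have := (hc.balanced i).1
    simp only [Superbin.jobs, List.length_append, List.length_map]
    omega
  have h5 : ((s.filter fun q => I.cls q = i).card : ℝ) ≤ 2 * c.threshold N O i := by
    exact_mod_cast h3.trans h4
  have h6 : (0 : ℝ) < 2 ^ i := by positivity
  have h0 := c.load_nonneg O
  have h7 : (c.threshold N O i : ℝ) * 2 ^ i ≤ N * c.load O := by
    rw [← le_div_iff₀ h6]
    exact Nat.floor_le (by positivity)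
  rw [h2]
  calc _ ≤ (2 * c.threshold N O i : ℝ) * 2 ^ i := by gcongr
    _ ≤ 2 * N * c.load O := by linarith

/-- The pending weight of the algorithm at any time is bounded by that of any schedule. -/
theorem pending_weight_le (hpick : PicksHeaviest pick) {S : Schedule I.n}
    (hS : I.Feasible S) (hμ : 1 < μ) (hI : I.HasDistortion μ) (t : ℝ) :
    ∑ q, (Ico (I.release q) (I.completionTime ((superbinAlgorithm μ pick).schedule I) q)).indicator
      (fun _ => I.weight q) t ≤
    24 * μ ^ 2 * max 1 (Real.logb 2 I.weightRatio) *
      ∑ q, (Icc (I.release q) (I.completionTime S q)).indicator (fun _ => I.weight q) t := by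
  classical
  set A := superbinAlgorithm μ pick with hA
  have hrhs : 0 ≤ ∑ q, (Icc (I.release q) (I.completionTime S q)).indicator
      (fun _ => I.weight q) t :=
    Finset.sum_nonneg fun q _ => indicator_nonneg (fun _ _ => (I.weight_pos q).le) _
  set s := Finset.univ.filter fun q : Fin I.n =>
    t ∈ Ico (I.release q) (I.completionTime (A.schedule I) q) with hs
  have hlhs : ∑ q, (Ico (I.release q) (I.completionTime (A.schedule I) q)).indicator
      (fun _ => I.weight q) t = ∑ q ∈ s, I.weight q := by
    rw [hs, Finset.sum_filter]
    exact Finset.sum_congr rfl fun q _ => by simp only [indicator_apply]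
  rw [hlhs]
  rcases s.eq_empty_or_nonempty with h0 | ⟨q, hq⟩
  · rw [h0, Finset.sum_empty]
    positivity
  have hF := feasible_schedule (μ := μ) hpick I
  have hlt : ∀ q ∈ s, (A.schedule I).processed q t < I.proc q := fun q hq =>
    hF.processed_lt_of_lt (Finset.mem_filter.1 hq).2.2
  obtain ⟨k, hk, hk'⟩ : ∃ k, (A.run I k).time ≤ t ∧ t < (A.run I (k + 1)).time := by
    have hex : ∃ k, t < (A.run I k).time := by
      obtain ⟨K, hK⟩ := exists_work_eq_proc (μ := μ) hpick I
      refine ⟨K, ?_⟩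
      by_contra! h
      have h1 := (A.schedule I).processed_mono q h
      rw [OnlineAlgorithm.processed_time, hK] at h1
      exact absurd (hlt q hq) (not_lt.2 h1)
    have hpos : Nat.find hex ≠ 0 := by
      intro h
      have h1 := Nat.find_spec hex
      rw [h] at h1
      have h2 : (0 : ℝ) ≤ t := (I.release_nonneg q).trans (Finset.mem_filter.1 hq).2.1
      exact absurd h1 (not_lt.2 h2)
    obtain ⟨k, hk⟩ := Nat.exists_eq_succ_of_ne_zero hpos
    refine ⟨k, not_lt.1 (Nat.find_min hex (by omega)), ?_⟩
    have h1 := Nat.find_spec hex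
    rwa [hk] at h1
  have hc := valid_run μ pick I k
  have hc1 := valid_run μ pick I (k + 1)
  set N := ⌈μ ^ 2⌉₊ with hN
  set O : Set (Fin I.n) := {q | I.release q ≤ t ∧ t ≤ I.completionTime S q} with hO
  -- The step whose interval contains `t` takes positive time, so it is not a release, and all jobs
  -- released by `t` have already arrived.
  have harr : (A.run I (k + 1)).arrived = (A.run I k).arrived := by
    have h := (A.run I k).stepCases_step
    have h1 : (A.run I k).time < (A.run I k).step.time := hk.trans_lt hk'
    change (A.run I k).step.arrived = _
    generalize (A.run I k).step = c' at h h1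
    cases h with
    | release h hr => exact absurd h1 (lt_irrefl _)
    | idle h hr hrun => rfl
    | work q hrun h hr hlt => rfl
    | complete q hrun hle => rfl
    | standstill h hrun => rfl
  have hpend : ∀ q ∈ s, q.1 < (A.run I k).arrived ∧ (A.run I k).work q < I.proc q := by
    intro q hq
    constructor
    · by_contra! h
      have h1 := hc1.le_release q (harr.trans_le h)
      exact absurd (hk'.trans_le h1) (not_lt.2 (Finset.mem_filter.1 hq).2.1)
    · rw [← OnlineAlgorithm.processed_time]
      exact ((A.schedule I).processed_mono q hk).trans_lt (hlt q hq)
  have h1 := hc.sum_weight_le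
    (length_partialBin_le hpick hS hμ (Nat.le_ceil _) hI hk hk') s hpend
  rw [← hO, ← hN] at h1
  have hload : (A.run I k).load O ≤ 2 * ∑ q, (Icc (I.release q) (I.completionTime S q)).indicator
      (fun _ => I.weight q) t := by
    rw [Config.load, Finset.mul_sum]
    refine Finset.sum_le_sum fun q _ => ?_
    by_cases hqO : q ∈ O
    · rw [indicator_of_mem (show t ∈ Icc _ _ from hqO)]
      have := (I.zpow_cls_lt q).le
      have := I.weight_pos q
      split_ifs <;> linarith
    · rw [if_neg fun h => hqO h.1]
      exact mul_nonneg zero_le_two (indicator_nonneg (fun _ _ => (I.weight_pos q).le) _)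
  -- Rounding up costs at most `1 ≤ μ ^ 2`.
  have hN2 : (N : ℝ) ≤ 2 * μ ^ 2 := by
    have := (Nat.ceil_lt_add_one (sq_nonneg μ)).le
    nlinarith
  have h0 := (A.run I k).load_nonneg O
  have hcard := I.card_classes_le
  refine h1.trans ?_
  set X := ∑ q, (Icc (I.release q) (I.completionTime S q)).indicator (fun _ => I.weight q) t
  -- The constant 24 is the product of 3 from the number of classes, 2 for the two bins, 2 from `N ≤
  -- 2 * μ ^ 2` and 2 from rounding the weights.
  calc (I.classes.card : ℝ) * (2 * N * (A.run I k).load O)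
      ≤ (3 * max 1 (Real.logb 2 I.weightRatio)) * (2 * (2 * μ ^ 2) * (2 * X)) := by gcongr
    _ = _ := by ring

/-- Weighted flow time is the integral of the pending weight over time. Intervals are closed for
`S`, so that a job outside `O` is completed strictly before `t`, and half-open for the algorithm;
the endpoints do not affect the integrals. -/
theorem flowTime_le (hpick : PicksHeaviest pick) {S : Schedule I.n}
    (hS : I.Feasible S) (hμ : 1 < μ) (hI : I.HasDistortion μ) :
    I.flowTime ((superbinAlgorithm μ pick).schedule I) ≤
      24 * μ ^ 2 * max 1 (Real.logb 2 I.weightRatio) * I.flowTime S := by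
  have hint1 : ∀ (a b w : ℝ), Integrable ((Ico a b).indicator fun _ => w) := fun a b w =>
    (integrable_indicator_iff measurableSet_Ico).2 (by simp [integrableOn_const_iff])
  have hint2 : ∀ (a b w : ℝ), Integrable ((Icc a b).indicator fun _ => w) := fun a b w =>
    (integrable_indicator_iff measurableSet_Icc).2 (by simp [integrableOn_const_iff])
  have hF := feasible_schedule (μ := μ) hpick I
  have h1 : I.flowTime ((superbinAlgorithm μ pick).schedule I) = ∫ t, ∑ q,
      (Ico (I.release q) (I.completionTime ((superbinAlgorithm μ pick).schedule I) q)).indicator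
        (fun _ => I.weight q) t := by
    rw [integral_finsetSum _ fun q _ => hint1 _ _ _]
    refine Finset.sum_congr rfl fun q _ => ?_
    rw [integral_indicator_const _ measurableSet_Ico,
      Real.volume_real_Ico_of_le (hF.release_le_completionTime q), smul_eq_mul, mul_comm]
  have h2 : I.flowTime S = ∫ t, ∑ q,
      (Icc (I.release q) (I.completionTime S q)).indicator (fun _ => I.weight q) t := by
    rw [integral_finsetSum _ fun q _ => hint2 _ _ _]
    refine Finset.sum_congr rfl fun q _ => ?_
    rw [integral_indicator_const _ measurableSet_Icc,
      Real.volume_real_Icc_of_le (hS.release_le_completionTime q), smul_eq_mul, mul_comm]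
  rw [h1, h2, ← integral_const_mul]
  refine integral_mono (integrable_finsetSum _ fun q _ => hint1 _ _ _)
    ((integrable_finsetSum _ fun q _ => hint2 _ _ _).const_mul _) fun t => ?_
  exact pending_weight_le hpick hS hμ hI t

end SPPT

theorem mainTheorem3 :
    ∃ C : ℝ, 0 < C ∧
      ∀ μ : ℝ, 1 < μ →
        ∀ pick : SPPT.SuperbinState → ℤ, SPPT.PicksHeaviest pick →
          (SPPT.superbinAlgorithm μ pick).IsRobustCompetitive μ
            (fun I => C * μ ^ 2 * max 1 (Real.logb 2 I.weightRatio)) :=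
  ⟨24, by norm_num, fun _ hμ _ hpick I hI =>
    ⟨SPPT.feasible_schedule hpick I, fun _ hS => SPPT.flowTime_le hpick hS hμ hI⟩⟩
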